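/- There exist a constant $C$, a polynomial $p$ and a deterministic algorithm (a program for a unit-cost random access machine whose arithmetic operations are addition, truncated subtraction and comparison) with the following property. Given any $n\ge 1$, any unweighted undirected simple graph $G=(V,E)$ on the vertex set $V=\{0,\dots,n-1\}$ (as an adjacency matrix) and any source vertex $s\in V$, the algorithm halts after at most $p(n)$ steps and outputs (as an adjacency matrix) a subgraph $H\subseteq G$ that is a dual failure FT-BFS structure of $G$ with respect to $s$, i.e. $\mathrm{dist}(s,v,H\setminus F)=\mathrm{dist}(s,v,G\setminus F)$ for every $v\in V$ and every set $F\subseteq E$ of at most two edges (distances count edges and may be $\infty$), and $H$ has at most $C\,n^{5/3}$ edges. -/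

import Mathlib

/-! ### Machine model: a unit-cost random access machine without multiplication

Programs are structured programs over finitely many natural-number registers and
finitely many one-dimensional arrays (the finitely many that occur in the program text).
The arithmetic is addition, truncated subtraction and comparison, so that after `t`
steps all numbers have `O(t)` bits more than the input, and polynomial time on this
machine is polynomial time on a Turing machine. -/

namespace RAM

/-- Expressions. -/
inductive Exp : Type
  | lit (k : ℕ) : Exp
  | var (x : ℕ) : Exp
  | get (a : ℕ) (i : Exp) : Exp
  | add (e₁ e₂ : Exp) : Exp
  | sub (e₁ e₂ : Exp) : Exp
  | lt (e₁ e₂ : Exp) : Exp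
  | eq (e₁ e₂ : Exp) : Exp

/-- Programs. Tests succeed when the value of the expression is not `0`. -/
inductive Prog : Type
  | skip : Prog
  | set (x : ℕ) (e : Exp) : Prog
  | put (a : ℕ) (i e : Exp) : Prog
  | seq (p q : Prog) : Prog
  | ite (e : Exp) (p q : Prog) : Prog
  | loop (e : Exp) (p : Prog) : Prog

/-- The contents of the registers and of the arrays. -/
@[ext]
structure State : Type where
  reg : ℕ → ℕ
  arr : ℕ → ℕ → ℕ

/-- The value of an expression. -/
def Exp.eval (σ : State) : Exp → ℕ
  | lit k => k
  | var x => σ.reg x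
  | get a i => σ.arr a (i.eval σ)
  | add e₁ e₂ => e₁.eval σ + e₂.eval σ
  | sub e₁ e₂ => e₁.eval σ - e₂.eval σ
  | lt e₁ e₂ => if e₁.eval σ < e₂.eval σ then 1 else 0
  | eq e₁ e₂ => if e₁.eval σ = e₂.eval σ then 1 else 0

/-- The time needed to evaluate an expression: one unit for each node. -/
def Exp.cost : Exp → ℕ
  | lit _ => 1
  | var _ => 1
  | get _ i => i.cost + 1
  | add e₁ e₂ => e₁.cost + e₂.cost + 1
  | sub e₁ e₂ => e₁.cost + e₂.cost + 1
  | lt e₁ e₂ => e₁.cost + e₂.cost + 1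
  | eq e₁ e₂ => e₁.cost + e₂.cost + 1

/-- Write `k` into register `x`. -/
def State.setReg (σ : State) (x k : ℕ) : State :=
  { σ with reg := Function.update σ.reg x k }

/-- Write `k` into cell `i` of array `a`. -/
def State.setArr (σ : State) (a i k : ℕ) : State :=
  { σ with arr := Function.update σ.arr a (Function.update (σ.arr a) i k) }

/-- `Exec p σ t τ`: started in state `σ`, the program `p` halts in state `τ`
after exactly `t` units of time. -/
inductive Exec : Prog → State → ℕ → State → Prop
  | skip (σ : State) : Exec Prog.skip σ 1 σ
  | set (σ : State) (x : ℕ) (e : Exp) :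
      Exec (Prog.set x e) σ (e.cost + 1) (σ.setReg x (e.eval σ))
  | put (σ : State) (a : ℕ) (i e : Exp) :
      Exec (Prog.put a i e) σ (i.cost + e.cost + 1) (σ.setArr a (i.eval σ) (e.eval σ))
  | seq {p q : Prog} {σ τ ρ : State} {t u : ℕ} :
      Exec p σ t τ → Exec q τ u ρ → Exec (Prog.seq p q) σ (t + u) ρ
  | ite_true {e : Exp} {p q : Prog} {σ τ : State} {t : ℕ} :
      e.eval σ ≠ 0 → Exec p σ t τ → Exec (Prog.ite e p q) σ (e.cost + t + 1) τ
  | ite_false {e : Exp} {p q : Prog} {σ τ : State} {t : ℕ} :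
      e.eval σ = 0 → Exec q σ t τ → Exec (Prog.ite e p q) σ (e.cost + t + 1) τ
  | loop_false {e : Exp} {p : Prog} {σ : State} :
      e.eval σ = 0 → Exec (Prog.loop e p) σ (e.cost + 1) σ
  | loop_true {e : Exp} {p : Prog} {σ τ ρ : State} {t u : ℕ} :
      e.eval σ ≠ 0 → Exec p σ t τ → Exec (Prog.loop e p) τ u ρ →
      Exec (Prog.loop e p) σ (e.cost + t + u + 1) ρ

open Classical in
/-- The initial state for the input `(G, s)`: register `0` holds the number `n` of
vertices, register `1` holds the vertex `s`, array `0` holds the adjacency matrix of `G`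
(row by row), and every other register and cell holds `0`. -/
noncomputable def input {n : ℕ} (G : SimpleGraph (Fin n)) (s : Fin n) : State where
  reg := fun x => if x = 0 then n else if x = 1 then (s : ℕ) else 0
  arr := fun a k =>
    if a = 0 ∧ ∃ u v : Fin n, k = (u : ℕ) * n + (v : ℕ) ∧ G.Adj u v then 1 else 0

open Classical in
/-- The state `τ` holds the adjacency matrix of `H` (row by row) in array `1`. -/
def Outputs {n : ℕ} (τ : State) (H : SimpleGraph (Fin n)) : Prop :=
  ∀ u v : Fin n, τ.arr 1 ((u : ℕ) * n + (v : ℕ)) = if H.Adj u v then 1 else 0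

end RAM

/-- `H` is an `f`-failure fault tolerant BFS structure of `G` with respect to the
source `s`: a subgraph of `G` such that after the failure of any set `F` of at most `f`
edges of `G`, all distances from `s` (possibly `∞`) in `H \ F` are those in `G \ F`.
For `f = 2` this is a dual failure FT-BFS structure. -/
def IsFTBFS {V : Type*} (f : ℕ) (G : SimpleGraph V) (s : V) (H : SimpleGraph V) : Prop :=
  H ≤ G ∧ ∀ F : Finset (Sym2 V), (F : Set (Sym2 V)) ⊆ G.edgeSet → F.card ≤ f →
    ∀ v : V, (H.deleteEdges (F : Set (Sym2 V))).edist s v =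
      (G.deleteEdges (F : Set (Sym2 V))).edist s v

/-!
The program starts with `H = G` and goes through all pairs of vertices; it deletes the edge between
them whenever `H` stays a dual failure FT-BFS structure, which it tests for each pair of failing
edges by growing balls around `s` in `G` and `H` simultaneously. Fault tolerance is monotone in `H`,
so no edge of the final `H` can be deleted. It remains to show that any such minimal structure has
`O(n ^ (5 / 3))` edges.

By minimality every edge of `H` is *essential* for one of its ends `v`: after the failure of some
set `F` of at most two edges, all shortest walks from `s` to `v` end with this edge
(`exists_isEssential`). So it suffices that `O(n ^ (2 / 3))` edges are essential for a fixed
vertex `v`.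

Fix a shortest path `p` from `s` to `v`. A shortest walk after a relevant failure follows `p` up to
some `p b` and then stays off `p` until it reaches `v`. If both failing edges are on `p`, the last
edge is determined by `p b` alone. Otherwise one failing edge is on `p`, and its only effect is an
upper bound `β` (the *level*) on `b`, while the other one, the fault `c`, is off `p`
(`IsEssential.critical`). This leaves a problem on walks of a relation `r` from `p 0, p 1, …` to
`v`: bound the number of vertices `u` such that for some `β` and `c` all shortest available walks end
with `u` (`card_critical_le`). For each such `u` take the *largest* possible level, with a shortest
walk `W u` of length `ℓ u` there. The walks are compared by exchanging tails at common vertices, and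
with the optimal walks in the absence of faults, whose last vertices are the *labels* of their
starting points. Let `k` be about `n ^ (1 / 3)`.

* Label classes are disjoint, so at most `n / k` of the vertices `u` have a label class with at
  least `k` elements, and these can be discarded. Of the other ones, at most `k` are labels of
  vertices of `p`, and these can be discarded, too.
* Each vertex lies on at most `k + 1` of the remaining walks `W u`, since the faults of the walks
  through it are distinct and among the last `k` edges of one optimal walk
  (`CriticalWalk.card_visits_le`).
* At most two of the walks have the same length: on one level the lengths are distinct
  (`CriticalWalk.length_ne`), and for three levels maximality of the levels gives a contradiction
  (`CriticalWalk.not_three_levels`).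
* If there are at least `(k + 2) * (k + 1)` walks `W u` with a level at most that of `W u₀`, then
  `ℓ u₀ ≤ d + n / k`, where `d` is the length of `p`: all but few of these walks avoid the fault of
  `W u₀`, hence they cross each of the `ℓ u₀ - d + 1` first layers of vertices at a given distance
  to `v` without that fault, and so each layer has at least `k` elements
  (`CriticalWalk.length_sub_mul_le`).

Thus all but `O(k ^ 2)` of the walks have lengths between `d` and `d + n / k`, and there are at most
two for each length.
-/

/-! ### walks towards a vertex -/

/-- `Tail r v x m u`: there is an `r`-walk of length `m` from `x` to `v` whose last vertex
before `v` is `u`. -/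
inductive Tail {V : Type*} (r : V → V → Prop) (v : V) : V → ℕ → V → Prop
  | last {u : V} : r u v → Tail r v u 1 u
  | cons {x y : V} {m : ℕ} {u : V} : r x y → Tail r v y m u → Tail r v x (m + 1) u

/-- The relation `r` with the (unordered) pair `c` removed. -/
def Avoid {V : Type*} (r : V → V → Prop) (c : Sym2 V) (x y : V) : Prop := r x y ∧ s(x, y) ≠ c

/-- The sequence `R 0, …, R m` is an `r`-walk to `v` with last vertex `u` before `v`. -/
structure IsTail {V : Type*} (r : V → V → Prop) (v : V) (R : ℕ → V) (m : ℕ) (u : V) : Prop where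
  pos : 0 < m
  last : R m = v
  pen : R (m - 1) = u
  step : ∀ j < m, r (R j) (R (j + 1))

section Tails

variable {V : Type*} {r r' : V → V → Prop} {v : V}

theorem Tail.pos {x u : V} {m : ℕ} (h : Tail r v x m u) : 0 < m := by
  cases h <;> omega

theorem Tail.mono (hr : ∀ x y, r x y → r' x y) {x u : V} {m : ℕ} (h : Tail r v x m u) :
    Tail r' v x m u := by
  induction h with
  | last h => exact .last (hr _ _ h)
  | cons h _ ih => exact .cons (hr _ _ h) ih

theorem Tail.eq_of_one {x u : V} (h : Tail r v x 1 u) : u = x := by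
  cases h with
  | last h => rfl
  | cons h h' => exact absurd h'.pos (by simp)

theorem Tail.pen_adj {x u : V} {m : ℕ} (h : Tail r v x m u) : r u v := by
  induction h with
  | last h => exact h
  | cons _ _ ih => exact ih

theorem Tail.exists_isTail {x u : V} {m : ℕ} (h : Tail r v x m u) :
    ∃ R : ℕ → V, R 0 = x ∧ IsTail r v R m u := by
  induction h with
  | @last u h =>
    refine ⟨fun j => if j = 0 then u else v, by simp, by simp, by simp, by simp, ?_⟩
    intro j hj
    obtain rfl : j = 0 := by omega
    simpa using h
  | @cons x y m u h _ ih =>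
    obtain ⟨R, h0, hR⟩ := ih
    refine ⟨fun j => if j = 0 then x else R (j - 1), by simp, by omega, by simpa using hR.last,
      ?_, ?_⟩
    · have := hR.pos
      simp [hR.pen]; omega
    · intro j hj
      rcases j with _ | j
      · simpa [h0] using h
      · simpa using hR.step j (by omega)

theorem IsTail.drop {R : ℕ → V} {m : ℕ} {u : V} (h : IsTail r v R m u) {j : ℕ} (hj : j < m)
    (hs : ∀ i, j ≤ i → i < m → r' (R i) (R (i + 1))) : Tail r' v (R j) (m - j) u := by
  obtain ⟨t, rfl⟩ : ∃ t, m = j + t + 1 := ⟨m - j - 1, by omega⟩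
  induction t generalizing j with
  | zero =>
    have h1 := hs j le_rfl hj
    have h2 := h.last
    have h3 := h.pen
    simp only [Nat.add_zero, Nat.add_sub_cancel] at h2 h3
    rw [h2, h3] at h1
    rw [h3, show j + 0 + 1 - j = 1 by omega]
    exact .last h1
  | succ t ih =>
    have e : j + (t + 1) + 1 = (j + 1) + t + 1 := by omega
    have := ih (j := j + 1) (e ▸ h) (by omega) (fun i hi hi' => hs i (by omega) (by omega))
    rw [show j + (t + 1) + 1 - j = ((j + 1) + t + 1 - (j + 1)) + 1 by omega]
    exact .cons (hs j le_rfl hj) this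

theorem Tail.prepend {R : ℕ → V} {j : ℕ} (hs : ∀ i < j, r (R i) (R (i + 1))) {m : ℕ} {u : V}
    (h : Tail r v (R j) m u) : Tail r v (R 0) (j + m) u := by
  induction j generalizing m with
  | zero => simpa using h
  | succ j ih =>
    have := ih (fun i hi => hs i (by omega)) (.cons (hs j (by omega)) h)
    rwa [show j + (m + 1) = j + 1 + m by omega] at this

theorem Tail.lift_walk {G : SimpleGraph V} (hr : ∀ x y, r x y → G.Adj x y) {x u : V} {m : ℕ}
    (h : Tail r v x m u) : ∃ w : G.Walk x u, w.length + 1 = m := by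
  induction h with
  | last h => exact ⟨.nil, rfl⟩
  | cons h _ ih =>
    obtain ⟨w, hw⟩ := ih
    exact ⟨.cons (hr _ _ h) w, by simp [hw]⟩

/-- Two walks to `v` with a common edge have a common vertex from which both still have to go on;
on the first walk it is not before the common edge. -/
theorem IsTail.common_vertex {r₁ r₂ : V → V → Prop} (hv : ∀ x y, r₂ x y → x ≠ v) {R R' : ℕ → V}
    {m m' : ℕ} {u u' : V} (h : IsTail r₁ v R m u) (h' : IsTail r₂ v R' m' u') {j j' : ℕ}
    (hj : j < m) (hj' : j' < m') (he : s(R j, R (j + 1)) = s(R' j', R' (j' + 1))) :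
    ∃ i i', j ≤ i ∧ i < m ∧ i' < m' ∧ R i = R' i' := by
  rcases Sym2.eq_iff.1 he with ⟨h1, -⟩ | ⟨-, h2⟩
  · exact ⟨j, j', le_rfl, hj, hj', h1⟩
  · refine ⟨j + 1, j', by omega, ?_, hj', h2⟩
    have h3 := hv _ _ (h'.step j' hj')
    rw [← h2] at h3
    by_contra hc
    exact h3 (by rw [show j + 1 = m by omega, h.last])

/-! ### distances to the target and labels -/

/-- The least length of an `r`-walk from `x` to `v` (`0` if there is none). -/
noncomputable def tailDist (r : V → V → Prop) (v x : V) : ℕ := sInf {m | ∃ u, Tail r v x m u}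

theorem tailDist_le {x u : V} {m : ℕ} (h : Tail r v x m u) : tailDist r v x ≤ m :=
  Nat.sInf_le ⟨u, h⟩

theorem exists_tail_tailDist {x u : V} {m : ℕ} (h : Tail r v x m u) :
    ∃ u', Tail r v x (tailDist r v x) u' :=
  Nat.sInf_mem (s := {m | ∃ u, Tail r v x m u}) ⟨m, u, h⟩

/-- Along a walk to `v` the distance to `v` takes all values up to its first value. -/
theorem IsTail.exists_tailDist_eq {R : ℕ → V} {m : ℕ} {u : V}
    (h : IsTail r v R m u) {q : ℕ} (hq : 0 < q) (hq' : q ≤ tailDist r v (R 0)) :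
    ∃ j < m, tailDist r v (R j) = q := by
  classical
  by_contra hc
  push Not at hc
  have : ∀ j < m, q < tailDist r v (R j) := by
    intro j
    induction j with
    | zero => intro hj; exact lt_of_le_of_ne hq' (hc 0 hj).symm
    | succ j ih =>
      intro hj
      have h1 := ih (by omega)
      obtain ⟨u', h2⟩ := exists_tail_tailDist (h.drop hj (fun i _ hi => h.step i hi))
      have := tailDist_le (.cons (h.step j (by omega)) h2)
      have := hc _ hj
      omega
  have h1 := this (m - 1) (by have := h.pos; omega)
  have h2 := tailDist_le (h.drop (j := m - 1) (by have := h.pos; omega) (fun i _ hi => h.step i hi))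
  have := h.pos
  omega

open Classical in
/-- The least vertex that precedes `v` on a shortest `r`-walk from `x` to `v`
(`x` itself if there is no walk). -/
noncomputable def tailLabel [LinearOrder V] [Finite V] (r : V → V → Prop) (v x : V) : V :=
  if h : {u | Tail r v x (tailDist r v x) u}.Nonempty then
    (wellFounded_lt (α := V)).min _ h else x

variable [LinearOrder V] [Finite V]

theorem tail_tailLabel {x u : V} {m : ℕ} (h : Tail r v x m u) :
    Tail r v x (tailDist r v x) (tailLabel r v x) := by
  have h' : {u | Tail r v x (tailDist r v x) u}.Nonempty := exists_tail_tailDist h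
  rw [tailLabel, dif_pos h']
  exact (wellFounded_lt (α := V)).min_mem _ h'

theorem tailLabel_le {x u : V} (h : Tail r v x (tailDist r v x) u) : tailLabel r v x ≤ u := by
  have h' : {u | Tail r v x (tailDist r v x) u}.Nonempty := ⟨u, h⟩
  rw [tailLabel, dif_pos h']
  exact not_lt.1 ((wellFounded_lt (α := V)).not_lt_min _ h)

theorem tailLabel_of_one {u : V} (h : r u v) : tailLabel r v u = u := by
  have h1 : Tail r v u 1 u := .last h
  have h2 := tail_tailLabel h1
  have h3 := tailDist_le h1
  have h4 := h2.pos
  rw [show tailDist r v u = 1 by omega] at h2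
  exact h2.eq_of_one

/-- A shortest walk to `v` with the least last vertex: along it the distance to `v` drops by one
in each step and the label is constant. -/
theorem exists_optimal {x u : V} {m : ℕ} (h : Tail r v x m u) :
    ∃ R : ℕ → V, R 0 = x ∧ IsTail r v R (tailDist r v x) (tailLabel r v x) ∧
      ∀ t < tailDist r v x, tailDist r v (R t) = tailDist r v x - t ∧
        tailLabel r v (R t) = tailLabel r v x := by
  obtain ⟨R, h0, hR⟩ := (tail_tailLabel h).exists_isTail
  refine ⟨R, h0, hR, fun t ht => ?_⟩
  have h1 := hR.drop ht (fun i _ hi => hR.step i hi)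
  have h2 : tailDist r v (R t) = tailDist r v x - t := by
    refine le_antisymm (tailDist_le h1) ?_
    obtain ⟨u', hu'⟩ := exists_tail_tailDist h1
    have := Tail.prepend (fun i hi => hR.step i (hi.trans ht)) hu'
    rw [h0] at this
    have := tailDist_le this
    omega
  refine ⟨h2, le_antisymm (tailLabel_le (by rwa [h2])) (tailLabel_le ?_)⟩
  have := Tail.prepend (fun i hi => hR.step i (hi.trans ht)) (tail_tailLabel h1)
  rwa [h0, h2, Nat.add_sub_of_le ht.le] at this

end Tails

/-! ### critical last edges -/

section Critical

variable {V : Type*}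

/-- A walk of length `ℓ` with last vertex `u` before `v` is available at level `β` with fault `c`:
it follows the sequence `p` for `b ≤ β` steps and continues with an `r`-walk from `p b` to `v`
that avoids `c`. -/
def Available (r : V → V → Prop) (v : V) (p : ℕ → V) (β : ℕ) (c : Sym2 V) (ℓ : ℕ) (u : V) : Prop :=
  ∃ b ≤ β, ∃ m, b + m = ℓ ∧ Tail (Avoid r c) v (p b) m u

/-- At level `β` with fault `c`, the shortest available walks have length `ℓ`, and all of them have
the last vertex `u` before `v`. -/
def IsCritical (r : V → V → Prop) (v : V) (p : ℕ → V) (β : ℕ) (c : Sym2 V) (ℓ : ℕ) (u : V) :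
    Prop :=
  Available r v p β c ℓ u ∧ ∀ ℓ' u', Available r v p β c ℓ' u' → ℓ ≤ ℓ' ∧ (ℓ' = ℓ → u' = u)

/-- A certificate that `u` is critical: a level `β < d`, the largest one at which `u` is critical,
a fault `c`, and the part `R` of a shortest available walk after its initial segment
`p 0, …, p b`. -/
structure CriticalWalk (r : V → V → Prop) (v : V) (p : ℕ → V) (d : ℕ) (u : V) where
  β : ℕ
  c : Sym2 V
  ℓ : ℕ
  b : ℕ
  m : ℕ
  R : ℕ → V
  β_lt : β < d
  critical : IsCritical r v p β c ℓ u
  b_le : b ≤ β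
  len : b + m = ℓ
  start : R 0 = p b
  tail : IsTail (Avoid r c) v R m u
  max : ∀ β', β < β' → β' < d → ∀ c' ℓ', ¬ IsCritical r v p β' c' ℓ' u

variable {r : V → V → Prop} {v : V} {p : ℕ → V} {d : ℕ}

theorem exists_criticalWalk {u : V} {β ℓ : ℕ} {c : Sym2 V} (hβ : β < d)
    (h : IsCritical r v p β c ℓ u) : Nonempty (CriticalWalk r v p d u) := by
  classical
  let S := (Finset.range d).filter fun β => ∃ c ℓ, IsCritical r v p β c ℓ u
  have hS : S.Nonempty := ⟨β, by
    simp only [S, Finset.mem_filter, Finset.mem_range]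
    exact ⟨hβ, c, ℓ, h⟩⟩
  have hm := S.max'_mem hS
  simp only [S, Finset.mem_filter, Finset.mem_range] at hm
  obtain ⟨h1, c', ℓ', h2⟩ := hm
  obtain ⟨b, hb, m, hl, ht⟩ := h2.1
  obtain ⟨R, h0, hR⟩ := ht.exists_isTail
  refine ⟨⟨_, c', ℓ', b, m, R, h1, h2, hb, hl, h0, hR, fun β' hlt hd c'' ℓ'' hc => ?_⟩⟩
  refine absurd (S.le_max' β' ?_) (not_le.2 hlt)
  simp only [S, Finset.mem_filter, Finset.mem_range]
  exact ⟨hd, c'', ℓ'', hc⟩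

namespace CriticalWalk

/-- The edge `c'` lies on the walk. -/
def Hits {u : V} (W : CriticalWalk r v p d u) (c' : Sym2 V) : Prop :=
  ∃ j < W.m, s(W.R j, W.R (j + 1)) = c'

/-- The vertex `w ≠ v` lies on the walk. -/
def Visits {u : V} (W : CriticalWalk r v p d u) (w : V) : Prop := ∃ j < W.m, W.R j = w

theorem step_avoid {u : V} (W : CriticalWalk r v p d u) {c' : Sym2 V} (h : ¬ W.Hits c') {i : ℕ}
    (hi : i < W.m) : Avoid r c' (W.R i) (W.R (i + 1)) :=
  ⟨(W.tail.step i hi).1, fun e => h ⟨i, hi, e⟩⟩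

theorem not_hits_self {u : V} (W : CriticalWalk r v p d u) : ¬ W.Hits W.c := by
  rintro ⟨j, hj, e⟩
  exact (W.tail.step j hj).2 e

/-- The part of the walk up to position `j` can be continued by any other tail. -/
theorem splice {u : V} (W : CriticalWalk r v p d u) {β' : ℕ} (hβ : W.b ≤ β') {c' : Sym2 V} {j : ℕ}
    (hs : ∀ i < j, Avoid r c' (W.R i) (W.R (i + 1))) {m : ℕ} {u' : V}
    (h : Tail (Avoid r c') v (W.R j) m u') : Available r v p β' c' (W.b + (j + m)) u' := by
  refine ⟨W.b, hβ, j + m, rfl, ?_⟩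
  have := Tail.prepend hs h
  rwa [W.start] at this

theorem available {u : V} (W : CriticalWalk r v p d u) {β' : ℕ} (hβ : W.b ≤ β') {c' : Sym2 V}
    (h : ¬ W.Hits c') : Available r v p β' c' W.ℓ u := by
  have := W.tail.drop W.tail.pos (fun i _ hi => W.step_avoid h hi)
  rw [W.start] at this
  exact ⟨W.b, hβ, W.m, W.len, this⟩

/-- Exchanging the tail of the walk after position `j` against a tail that avoids the fault does
not shorten it, and makes it longer unless the last vertex stays the same. -/
theorem le_of_tail {u : V} (W : CriticalWalk r v p d u) {j : ℕ} (hj : j < W.m) {m : ℕ} {u' : V}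
    (h : Tail (Avoid r W.c) v (W.R j) m u') : W.m - j ≤ m ∧ (m = W.m - j → u' = u) := by
  have := W.critical.2 _ _ (W.splice W.b_le (fun i hi => W.tail.step i (hi.trans hj)) h)
  have hl := W.len
  exact ⟨by omega, fun e => this.2 (by omega)⟩

theorem hits_of_tail {u : V} (W : CriticalWalk r v p d u) {j : ℕ} (hj : j < W.m) {m : ℕ} {u' : V}
    {R' : ℕ → V} (h0 : R' 0 = W.R j) (h : IsTail r v R' m u') (hm : m ≤ W.m - j) (hu : u' ≠ u) :
    ∃ i < m, s(R' i, R' (i + 1)) = W.c := by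
  by_contra hc
  push Not at hc
  have := h.drop (r' := Avoid r W.c) h.pos (fun i _ hi => ⟨h.step i hi, hc i hi⟩)
  rw [h0, Nat.sub_zero] at this
  have := W.le_of_tail hj this
  exact hu (this.2 (by omega))

variable {u₁ u₂ u₃ : V}

theorem hits_of_le (W₁ : CriticalWalk r v p d u₁) (W₂ : CriticalWalk r v p d u₂) (hu : u₁ ≠ u₂)
    (hβ : W₁.β ≤ W₂.β) (hℓ : W₁.ℓ ≤ W₂.ℓ) : W₁.Hits W₂.c := by
  by_contra h
  have := W₂.critical.2 _ _ (W₁.available (W₁.b_le.trans hβ) h)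
  exact hu (this.2 (by omega))

/-- Of two critical walks the one at the smaller level is at least as long. The reason is the
maximality of the smaller level `W₁.β`: at the level `W₂.β` and with the fault `W₁.c` some shortest
available walk `P` does not end with `u₁`. If the inequality failed, then both `W₁` and `P` would
have to use the edge `W₂.c`, and exchanging their tails there would shorten one of them.
In the case of equality the exchange argument shows which walks are shortest. -/
theorem lt_level (hv : ∀ x y, r x y → x ≠ v) (W₁ : CriticalWalk r v p d u₁)
    (W₂ : CriticalWalk r v p d u₂) (hu : u₁ ≠ u₂) (hβ : W₁.β < W₂.β) (hℓ : W₁.ℓ ≤ W₂.ℓ) :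
    W₁.ℓ = W₂.ℓ ∧ Available r v p W₂.β W₁.c W₁.ℓ u₂ ∧
      ∀ ℓ u, Available r v p W₂.β W₁.c ℓ u → W₁.ℓ ≤ ℓ ∧ (ℓ = W₁.ℓ → u = u₁ ∨ u = u₂) := by
  classical
  have key : ∀ ℓ u, Available r v p W₂.β W₁.c ℓ u →
      (∀ ℓ' u', Available r v p W₂.β W₁.c ℓ' u' → ℓ ≤ ℓ') → u ≠ u₁ →
      W₂.ℓ ≤ ℓ ∧ (ℓ = W₂.ℓ → u = u₂) := by
    rintro ℓ u ⟨b, hb, m, rfl, ht⟩ hmin hne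
    obtain ⟨R, h0, hR⟩ := ht.exists_isTail
    by_cases hh : ∃ j < m, s(R j, R (j + 1)) = W₂.c
    · exfalso
      obtain ⟨j, hj, e⟩ := hh
      obtain ⟨j₁, hj₁, e₁⟩ := W₁.hits_of_le W₂ hu hβ.le hℓ
      obtain ⟨i₁, i, -, hi₁, hi, hw⟩ := W₁.tail.common_vertex (fun x y h => hv x y h.1) hR hj₁ hj
        (e₁.trans e.symm)
      have t₁ := W₁.tail.drop hi₁ (fun i _ hi => W₁.tail.step i hi)
      have t := hR.drop hi (fun i _ hi => hR.step i hi)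
      have c₁ := W₁.le_of_tail hi₁ (hw ▸ t)
      have c₂ : m - i ≠ W₁.m - i₁ := fun h => hne (c₁.2 h)
      have t₂ := Tail.prepend (fun t ht => hR.step t (ht.trans hi)) (hw ▸ t₁)
      rw [h0] at t₂
      have := hmin _ _ ⟨b, hb, _, rfl, t₂⟩
      omega
    · push Not at hh
      have := hR.drop (r' := Avoid r W₂.c) hR.pos (fun i _ hi => ⟨(hR.step i hi).1, hh i hi⟩)
      rw [h0] at this
      exact W₂.critical.2 _ _ ⟨b, hb, m, rfl, this⟩
  have hav := W₁.available (W₁.b_le.trans hβ.le) W₁.not_hits_self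
  have hex : ∃ ℓ, ∃ u, Available r v p W₂.β W₁.c ℓ u := ⟨_, _, hav⟩
  have hmin : ∀ ℓ' u', Available r v p W₂.β W₁.c ℓ' u' → Nat.find hex ≤ ℓ' :=
    fun ℓ' u' h => Nat.find_min' hex ⟨u', h⟩
  have h1 := hmin _ _ hav
  have hnc := W₁.max W₂.β hβ W₂.β_lt W₁.c (Nat.find hex)
  obtain ⟨u, hu', hne⟩ : ∃ u, Available r v p W₂.β W₁.c (Nat.find hex) u ∧ u ≠ u₁ := by
    by_contra hcon
    push Not at hcon
    obtain ⟨u, hu'⟩ := Nat.find_spec hex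
    have := hcon u hu'
    subst this
    exact hnc ⟨hu', fun ℓ' u' h => ⟨hmin _ _ h, fun e => hcon u' (e ▸ h)⟩⟩
  have h2 := key _ _ hu' hmin hne
  have e : Nat.find hex = W₁.ℓ := by omega
  obtain rfl := h2.2 (by omega)
  rw [e] at hu' hmin h2
  refine ⟨by omega, hu', fun ℓ u' h => ⟨hmin _ _ h, fun e' => ?_⟩⟩
  subst e'
  by_cases h3 : u' = u₁
  · exact .inl h3
  · exact .inr ((key _ _ h hmin h3).2 (by omega))

theorem not_three_levels (hv : ∀ x y, r x y → x ≠ v) (W₁ : CriticalWalk r v p d u₁)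
    (W₂ : CriticalWalk r v p d u₂) (W₃ : CriticalWalk r v p d u₃) (h₁₂ : u₁ ≠ u₂) (h₁₃ : u₁ ≠ u₃)
    (h₂₃ : u₂ ≠ u₃) (hβ : W₁.β < W₂.β) (hβ' : W₂.β < W₃.β) (hℓ : W₁.ℓ = W₂.ℓ)
    (hℓ' : W₁.ℓ = W₃.ℓ) : False := by
  obtain ⟨-, ⟨b, hb, m, hm, ht⟩, -⟩ := lt_level hv W₁ W₂ h₁₂ hβ hℓ.le
  obtain ⟨-, -, h⟩ := lt_level hv W₁ W₃ h₁₃ (hβ.trans hβ') hℓ'.le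
  rcases (h _ _ ⟨b, hb.trans hβ'.le, m, hm, ht⟩).2 rfl with h | h
  · exact h₁₂ h.symm
  · exact h₂₃ h

variable [LinearOrder V] [Finite V]

/-- At one level the critical walks have distinct lengths, labels of `p 0, …, p (d - 1)` aside. -/
theorem length_ne (hv : ∀ x y, r x y → x ≠ v) (W₁ : CriticalWalk r v p d u₁)
    (W₂ : CriticalWalk r v p d u₂) (hu : u₁ ≠ u₂) (hE₁ : ∀ b < d, tailLabel r v (p b) ≠ u₁)
    (hE₂ : ∀ b < d, tailLabel r v (p b) ≠ u₂) (hβ : W₁.β = W₂.β) : W₁.ℓ ≠ W₂.ℓ := by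
  classical
  intro hℓ
  -- A shortest walk at this level without any fault.
  let S : Set ℕ := {n | ∃ b ≤ W₁.β, ∃ u m, Tail r v (p b) m u ∧ n = b + m}
  have hmem : ∀ {u : V} (W : CriticalWalk r v p d u), W.β = W₁.β → W.ℓ ∈ S := fun {u} W hW =>
    ⟨W.b, hW ▸ W.b_le, u, W.m, by
      have := W.tail.drop W.tail.pos (fun i _ hi => (W.tail.step i hi).1)
      rwa [W.start] at this, W.len.symm⟩
  obtain ⟨b, hb, u, m, ht, hn⟩ := Nat.sInf_mem (s := S) ⟨_, hmem W₁ rfl⟩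
  have hbd : b < d := hb.trans_lt W₁.β_lt
  have hmin : ∀ n ∈ S, b + m ≤ n := fun n h => hn ▸ Nat.sInf_le h
  have hm : tailDist r v (p b) = m := by
    refine le_antisymm (tailDist_le ht) ?_
    obtain ⟨u', hu'⟩ := exists_tail_tailDist ht
    have := hmin _ ⟨b, hb, u', _, hu', rfl⟩
    omega
  obtain ⟨Q, h0, hQ, hd⟩ := exists_optimal ht
  rw [hm] at hQ hd
  have hit : ∀ {u : V} (W : CriticalWalk r v p d u), W.β = W₁.β →
      (∀ b < d, tailLabel r v (p b) ≠ u) → ∃ j < m, s(Q j, Q (j + 1)) = W.c := by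
    intro u W hW hE
    by_contra hc
    push Not at hc
    have := hQ.drop (r' := Avoid r W.c) hQ.pos (fun i _ hi => ⟨hQ.step i hi, hc i hi⟩)
    rw [h0] at this
    have := W.critical.2 _ _ ⟨b, hW ▸ hb, _, rfl, this⟩
    have h2 := hmin _ (hmem W hW)
    exact hE b hbd (this.2 (by omega))
  -- The walk whose fault comes first on `Q` can follow `Q` from the other fault on.
  have main : ∀ {u u' : V} (W : CriticalWalk r v p d u) (W' : CriticalWalk r v p d u'),
      W.β = W₁.β → (∀ b < d, tailLabel r v (p b) ≠ u) → W.Hits W'.c → ∀ j j', j < j' → j' < m →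
      s(Q j, Q (j + 1)) = W.c → s(Q j', Q (j' + 1)) = W'.c → False := by
    intro u u' W W' hW hE hh j j' hjj hj' e e'
    obtain ⟨t, htm, et⟩ := hh
    obtain ⟨i, i', hji, him, hi', hw⟩ := hQ.common_vertex (fun x y h => hv x y h.1) W.tail
      hj' htm (e'.trans et.symm)
    have tl := hQ.drop (r' := Avoid r W.c) him (fun k hk hkm => ⟨hQ.step k hkm, fun hc => by
      rcases Sym2.eq_iff.1 (e.trans hc.symm) with ⟨h1, -⟩ | ⟨h1, -⟩
      · have a1 := (hd j (by omega)).1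
        have a2 := (hd k hkm).1
        rw [h1] at a1
        omega
      · have a1 := (hd j (by omega)).1
        by_cases hk' : k + 1 < m
        · have a2 := (hd (k + 1) hk').1
          rw [h1] at a1
          omega
        · rw [show k + 1 = m by omega, hQ.last] at h1
          exact hv _ _ (hQ.step j (by omega)) h1⟩)
    have c1 := W.le_of_tail hi' (hw ▸ tl)
    have t2 := W.tail.drop hi' (r' := r) (fun i _ hi => (W.tail.step i hi).1)
    rw [← hw] at t2
    have := tailDist_le t2
    rw [(hd i him).1] at this
    exact hE b hbd (c1.2 (by omega))
  obtain ⟨j₁, hj₁, e₁⟩ := hit W₁ rfl hE₁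
  obtain ⟨j₂, hj₂, e₂⟩ := hit W₂ hβ.symm hE₂
  have k₁ := W₁.hits_of_le W₂ hu hβ.le hℓ.le
  have k₂ := W₂.hits_of_le W₁ hu.symm hβ.ge hℓ.ge
  rcases lt_trichotomy j₁ j₂ with h | h | h
  · exact main W₁ W₂ rfl hE₁ k₁ j₁ j₂ h hj₂ e₁ e₂
  · subst h
    rw [← e₂, e₁] at k₁
    exact W₁.not_hits_self k₁
  · exact main W₂ W₁ hβ.symm hE₂ k₂ j₂ j₁ h hj₁ e₂ e₁

end CriticalWalk

end Critical

/-! ### counting critical last edges -/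

section Counting

variable {V : Type*} [Fintype V] [LinearOrder V] {r : V → V → Prop} {v : V} {p : ℕ → V} {d k : ℕ}

/-- The vertices with label `u`. -/
noncomputable def labelClass (r : V → V → Prop) (v u : V) : Finset V :=
  Finset.univ.filter fun x => tailLabel r v x = u

theorem tailDist_le_card_labelClass {x u : V} {m : ℕ} (h : Tail r v x m u) :
    tailDist r v x ≤ (labelClass r v (tailLabel r v x)).card := by
  obtain ⟨R, -, -, hR⟩ := exists_optimal h
  have : (Finset.range (tailDist r v x)).card ≤ (labelClass r v (tailLabel r v x)).card := by
    refine Finset.card_le_card_of_injOn R ?_ ?_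
    · intro t ht
      simp only [Finset.coe_range, Set.mem_Iio] at ht
      simp [labelClass, (hR t ht).2]
    · intro s hs t ht hst
      simp only [Finset.coe_range, Set.mem_Iio] at hs ht
      have h1 := (hR s hs).1
      have h2 := (hR t ht).1
      rw [hst] at h1
      omega
  simpa using this

/-- Few label classes are large, as they are disjoint. -/
theorem card_mul_le_of_labelClass (U : Finset V) (hU : ∀ u ∈ U, k ≤ (labelClass r v u).card) :
    U.card * k ≤ Fintype.card V := by
  calc U.card * k ≤ ∑ u ∈ U, (labelClass r v u).card := by
        simpa using Finset.card_nsmul_le_sum U _ k hU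
    _ = (U.biUnion (labelClass r v)).card := by
        rw [Finset.card_biUnion]
        intro a _ b _ hab
        refine Finset.disjoint_left.2 fun x hx hx' => ?_
        simp only [labelClass, Finset.mem_filter, Finset.mem_univ, true_and] at hx hx'
        exact hab (hx.symm.trans hx')
    _ ≤ _ := Finset.card_le_univ _

/-- Few labels of `p 0, …, p (d - 1)` have small classes: only the vertices `p b` with `b` close
to `d` can have them. -/
theorem card_le_of_labels (hd : ∀ b < d, ∀ m u, Tail r v (p b) m u → d ≤ b + m) (U : Finset V)
    (hU : ∀ u ∈ U, (labelClass r v u).card < k)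
    (hE : ∀ u ∈ U, ∃ b < d, tailLabel r v (p b) = u ∧ ∃ m u', Tail r v (p b) m u') :
    U.card ≤ k := by
  have hE' : ∀ u : V, ∃ b, u ∈ U → b < d ∧ tailLabel r v (p b) = u ∧ d < b + k := by
    intro u
    by_cases hu : u ∈ U
    · obtain ⟨b, hb, hl, m, u', ht⟩ := hE u hu
      refine ⟨b, fun _ => ⟨hb, hl, ?_⟩⟩
      have h1 := tailDist_le_card_labelClass ht
      obtain ⟨u'', h2⟩ := exists_tail_tailDist ht
      have h3 := hd b hb _ _ h2
      have h4 := hU u hu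
      rw [hl] at h1
      omega
    · exact ⟨0, fun h => absurd h hu⟩
  choose b hb using hE'
  have : U.card ≤ (Finset.Ico (d - k) d).card := by
    refine Finset.card_le_card_of_injOn b ?_ ?_
    · intro u hu
      have := hb u hu
      simp only [Finset.coe_Ico, Set.mem_Ico]
      omega
    · intro s hs t ht hst
      rw [← (hb s hs).2.1, ← (hb t ht).2.1, hst]
  rw [Nat.card_Ico] at this
  omega

namespace CriticalWalk

/-- If `u` is not the label of some `p b` and has a small label class, then the fault is close to
`v`: the walk enters the label class of `u` near `v`, and it does not follow the optimal walk from
the last vertex before that only because of the fault. -/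
theorem tailDist_fault_le (hv : ∀ x y, r x y → x ≠ v) {u : V} (W : CriticalWalk r v p d u)
    (hE : ∀ b < d, tailLabel r v (p b) ≠ u) (hk : (labelClass r v u).card < k) :
    ∀ y ∈ W.c, tailDist r v y ≤ k := by
  classical
  have hlast : tailLabel r v (W.R (W.m - 1)) = u := by
    rw [W.tail.pen]
    have := W.tail.step (W.m - 1) (by have := W.tail.pos; omega)
    rw [W.tail.pen, Nat.sub_add_cancel W.tail.pos, W.tail.last] at this
    exact tailLabel_of_one this.1
  have hex : ∃ j, j < W.m ∧ ∀ i, j ≤ i → i < W.m → tailLabel r v (W.R i) = u :=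
    ⟨W.m - 1, by have := W.tail.pos; omega, fun i h1 h2 => by
      rwa [show i = W.m - 1 by omega]⟩
  obtain ⟨hj, hj'⟩ := Nat.find_spec hex
  have hpos : Nat.find hex ≠ 0 := by
    intro h0
    rw [h0] at hj'
    have := hj' 0 le_rfl W.tail.pos
    rw [W.start] at this
    exact hE _ (W.b_le.trans_lt W.β_lt) this
  obtain ⟨j, hjj⟩ := Nat.exists_eq_succ_of_ne_zero hpos
  have hne : tailLabel r v (W.R j) ≠ u := by
    intro he
    refine Nat.find_min hex (m := j) (by omega) ⟨by omega, fun i h1 h2 => ?_⟩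
    rcases h1.eq_or_lt with rfl | h1
    · exact he
    · exact hj' i (by omega) h2
  rw [hjj] at hj hj'
  have tl : ∀ i < W.m, Tail r v (W.R i) (W.m - i) u := fun i hi =>
    W.tail.drop hi (fun i _ hi => (W.tail.step i hi).1)
  have h1 := tailDist_le_card_labelClass (tl _ hj)
  rw [hj' _ le_rfl hj] at h1
  obtain ⟨u', h2⟩ := exists_tail_tailDist (tl _ hj)
  have h3 := tailDist_le (.cons (W.tail.step j (by omega)).1 h2)
  obtain ⟨R, h0, hR, hR'⟩ := exists_optimal (tl j (by omega))
  obtain ⟨i, hi, e⟩ := W.hits_of_tail (by omega) h0 hR (tailDist_le (tl j (by omega))) hne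
  intro y hy
  rw [← e, Sym2.mem_iff] at hy
  rcases hy with rfl | rfl
  · have := (hR' i hi).1
    omega
  · by_cases hi' : i + 1 < tailDist r v (W.R j)
    · have := (hR' _ hi').1
      omega
    · rw [show i + 1 = tailDist r v (W.R j) by omega, hR.last]
      have : tailDist r v v = 0 := by
        by_contra hne
        obtain ⟨_, t, ht⟩ := Nat.nonempty_of_pos_sInf (Nat.pos_of_ne_zero hne)
        cases ht with
        | last h => exact hv _ _ h rfl
        | cons h _ => exact hv _ _ h rfl
      omega

variable {ι : Type*} {u : ι → V}

/-- Each vertex `w` lies on few critical walks: the faults of these walks are distinct, and all of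
them (but at most one) are on the last `k` edges of the optimal walk from `w`. -/
theorem card_visits_le (hv : ∀ x y, r x y → x ≠ v) (hu : Function.Injective u)
    (W : ∀ i, CriticalWalk r v p d (u i)) (hE : ∀ i, ∀ b < d, tailLabel r v (p b) ≠ u i)
    (hk : ∀ i, (labelClass r v (u i)).card < k) (w : V) (T : Finset ι)
    (hT : ∀ i ∈ T, (W i).Visits w) : T.card ≤ k + 1 := by
  classical
  rcases T.eq_empty_or_nonempty with rfl | ⟨i₀, hi₀⟩
  · simp
  have tl : ∀ i, ∀ j < (W i).m, Tail r v ((W i).R j) ((W i).m - j) (u i) := fun i j hj =>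
    (W i).tail.drop hj (fun i' _ hi => ((W i).tail.step i' hi).1)
  obtain ⟨j₀, hj₀, e₀⟩ := hT i₀ hi₀
  have h0 := tl i₀ j₀ hj₀
  rw [e₀] at h0
  obtain ⟨R, hR0, hR, hR'⟩ := exists_optimal h0
  have hpos : ∀ i, ∃ t, i ∈ T → u i ≠ tailLabel r v w →
      t < tailDist r v w ∧ s(R t, R (t + 1)) = (W i).c ∧ tailDist r v w - t ≤ k := by
    intro i
    by_cases h : i ∈ T ∧ u i ≠ tailLabel r v w
    · obtain ⟨j, hj, e⟩ := hT i h.1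
      have h1 := tl i j hj
      rw [e] at h1
      obtain ⟨t, ht, et⟩ := (W i).hits_of_tail hj (hR0.trans e.symm) hR (tailDist_le h1) h.2.symm
      refine ⟨t, fun _ _ => ⟨ht, et, ?_⟩⟩
      rw [← (hR' t ht).1]
      refine (W i).tailDist_fault_le hv (hE i) (hk i) _ ?_
      rw [← et]
      exact Sym2.mem_mk_left _ _
    · exact ⟨0, fun h1 h2 => absurd ⟨h1, h2⟩ h⟩
  choose t ht using hpos
  have hinj : ∀ i ∈ T, ∀ i' ∈ T, (W i).c = (W i').c → i = i' := by
    have : ∀ i ∈ T, ∀ i' ∈ T, (W i).c = (W i').c → ∀ j j', j < (W i).m → j' < (W i').m →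
        (W i).R j = w → (W i').R j' = w → (W i).m - j ≤ (W i').m - j' → i = i' := by
      intro i hi i' hi' hc j j' hj hj' e e' hle
      have h1 := (W i).tail.drop hj (fun i _ hi => (W _).tail.step i hi)
      rw [hc, e, ← e'] at h1
      have := (W i').le_of_tail hj' h1
      exact hu (this.2 (by omega))
    intro i hi i' hi' hc
    obtain ⟨j, hj, e⟩ := hT i hi
    obtain ⟨j', hj', e'⟩ := hT i' hi'
    rcases le_total ((W i).m - j) ((W i').m - j') with h | h
    · exact this i hi i' hi' hc j j' hj hj' e e' h
    · exact (this i' hi' i hi hc.symm j' j hj' hj e' e h).symm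
  have h1 : (T.filter fun i => u i = tailLabel r v w).card ≤ 1 := by
    rw [Finset.card_le_one]
    intro a ha b hb
    simp only [Finset.mem_filter] at ha hb
    exact hu (ha.2.trans hb.2.symm)
  have h2 : (T.filter fun i => ¬ u i = tailLabel r v w).card ≤ (Finset.Icc 1 k).card := by
    refine Finset.card_le_card_of_injOn (fun i => tailDist r v w - t i) ?_ ?_
    · intro i hi
      rw [Finset.mem_coe, Finset.mem_filter] at hi
      have := ht i hi.1 hi.2
      simp only [Finset.coe_Icc, Set.mem_Icc]
      omega
    · intro i hi i' hi' he
      rw [Finset.mem_coe, Finset.mem_filter] at hi hi'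
      have a1 := ht i hi.1 hi.2
      have a2 := ht i' hi'.1 hi'.2
      simp only at he
      refine hinj i hi.1 i' hi'.1 ?_
      rw [← a1.2.1, ← a2.2.1, show t i = t i' by omega]
  rw [Nat.card_Icc] at h2
  have := Finset.card_filter_add_card_filter_not (s := T) (fun i => u i = tailLabel r v w)
  omega

/-- If many critical walks are at levels up to that of the walk `W i₀`, then `W i₀` is not long:
most of them avoid the fault of `W i₀` and hence cross every layer of vertices
at a given distance to `v` in the absence of that fault, so that the layers are large. -/
theorem length_sub_mul_le (hv : ∀ x y, r x y → x ≠ v) (hu : Function.Injective u)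
    (W : ∀ i, CriticalWalk r v p d (u i)) (hE : ∀ i, ∀ b < d, tailLabel r v (p b) ≠ u i)
    (hk : ∀ i, (labelClass r v (u i)).card < k) (i₀ : ι) (T : Finset ι)
    (hT : ∀ i ∈ T, (W i).β ≤ (W i₀).β) (hcard : (k + 2) * (k + 1) ≤ T.card) :
    ((W i₀).ℓ - d + 1) * k ≤ Fintype.card V := by
  classical
  have hvis := card_visits_le hv hu W hE hk
  set c := (W i₀).c with hc
  have h1 : (T.filter fun i => (W i).Hits c).card ≤ 2 * (k + 1) := by
    obtain ⟨x, y, hxy⟩ : ∃ x y, c = s(x, y) := by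
      induction c using Sym2.ind with | _ x y => exact ⟨x, y, rfl⟩
    have hsub : (T.filter fun i => (W i).Hits c) ⊆
        (T.filter fun i => (W i).Visits x) ∪ (T.filter fun i => (W i).Visits y) := by
      intro i hi
      simp only [Finset.mem_filter, Finset.mem_union] at hi ⊢
      obtain ⟨hi, j, hj, e⟩ := hi
      rw [hxy] at e
      rcases Sym2.eq_iff.1 e with ⟨e, -⟩ | ⟨e, -⟩
      · exact .inl ⟨hi, j, hj, e⟩
      · exact .inr ⟨hi, j, hj, e⟩
    have a1 := hvis x (T.filter fun i => (W i).Visits x) (by simp)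
    have a2 := hvis y (T.filter fun i => (W i).Visits y) (by simp)
    have := Finset.card_le_card hsub
    have := Finset.card_union_le (T.filter fun i => (W i).Visits x)
      (T.filter fun i => (W i).Visits y)
    omega
  set T' := T.filter fun i => ¬ (W i).Hits c with hT'
  have h2 : k * (k + 1) ≤ T'.card := by
    have := Finset.card_filter_add_card_filter_not (s := T) (fun i => (W i).Hits c)
    have e : (k + 2) * (k + 1) = k * (k + 1) + 2 * (k + 1) := by ring
    simp only [hT']
    omega
  let layer : ℕ → Finset V := fun q => Finset.univ.filter fun w => tailDist (Avoid r c) v w = q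
  have hlayer : ∀ q ∈ Finset.Icc 1 ((W i₀).ℓ - d + 1), k ≤ (layer q).card := by
    intro q hq
    rw [Finset.mem_Icc] at hq
    have hw : ∀ i, ∃ w, i ∈ T' → w ∈ layer q ∧ (W i).Visits w := by
      intro i
      by_cases hi : i ∈ T'
      · rw [hT', Finset.mem_filter] at hi
        have ht : IsTail (Avoid r c) v (W i).R (W i).m (u i) :=
          ⟨(W i).tail.pos, (W i).tail.last, (W i).tail.pen, fun j hj => (W i).step_avoid hi.2 hj⟩
        have h3 := ht.drop ht.pos (fun i _ hi => ht.step i hi)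
        obtain ⟨u', h4⟩ := exists_tail_tailDist h3
        have h5 := ((W i₀).critical.2 _ _ ((W i).splice (j := 0)
          ((W i).b_le.trans (hT i hi.1)) (by simp) h4)).1
        have h6 := (W i).b_le.trans_lt (W i).β_lt
        have h7 := h4.pos
        obtain ⟨j, hj, e⟩ := ht.exists_tailDist_eq (q := q) (by omega) (by omega)
        exact ⟨(W i).R j, fun _ => ⟨by simp [layer, e], j, hj, rfl⟩⟩
      · exact ⟨v, fun h => absurd h hi⟩
    choose w hw using hw
    have h3 := Finset.card_le_mul_card_image_of_maps_to (s := T') (t := layer q) (f := w)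
      (fun i hi => (hw i hi).1) (k + 1) (fun x _ => hvis x _ (by
        intro i hi
        rw [Finset.mem_filter] at hi
        exact hi.2 ▸ (hw i hi.1).2))
    have h4 : (k + 1) * k ≤ (k + 1) * (layer q).card := by
      rw [mul_comm (k + 1) k]; exact h2.trans h3
    exact Nat.le_of_mul_le_mul_left h4 (by omega)
  calc ((W i₀).ℓ - d + 1) * k ≤ ∑ q ∈ Finset.Icc 1 ((W i₀).ℓ - d + 1), (layer q).card := by
        have := Finset.card_nsmul_le_sum _ _ k hlayer
        simpa using this
    _ = ((Finset.Icc 1 ((W i₀).ℓ - d + 1)).biUnion layer).card := by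
        rw [Finset.card_biUnion]
        intro a _ b _ hab
        refine Finset.disjoint_left.2 fun x hx hx' => ?_
        simp only [layer, Finset.mem_filter, Finset.mem_univ, true_and] at hx hx'
        exact hab (hx.symm.trans hx')
    _ ≤ _ := Finset.card_le_univ _

/-- At most two critical walks have the same length. -/
theorem card_length_eq_le (hv : ∀ x y, r x y → x ≠ v) (hu : Function.Injective u)
    (W : ∀ i, CriticalWalk r v p d (u i)) (hE : ∀ i, ∀ b < d, tailLabel r v (p b) ≠ u i) (n : ℕ)
    (T : Finset ι) (hT : ∀ i ∈ T, (W i).ℓ = n) : T.card ≤ 2 := by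
  classical
  by_contra hc
  obtain ⟨a, ha, b, hb, c, hcT, hab, hac, hbc⟩ := Finset.two_lt_card.1 (not_le.1 hc)
  have hne : ∀ i ∈ T, ∀ j ∈ T, i ≠ j → (W i).β ≠ (W j).β := fun i hi j hj hij hβ =>
    length_ne hv (W i) (W j) (fun h => hij (hu h)) (hE i) (hE j) hβ ((hT i hi).trans (hT j hj).symm)
  have key : ∀ i ∈ T, ∀ j ∈ T, ∀ l ∈ T, (W i).β < (W j).β → (W j).β < (W l).β → False := by
    intro i hi j hj l hl h1 h2
    have n1 : i ≠ j := by rintro rfl; omega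
    have n2 : i ≠ l := by rintro rfl; omega
    have n3 : j ≠ l := by rintro rfl; omega
    exact not_three_levels hv (W i) (W j) (W l) (fun h => n1 (hu h)) (fun h => n2 (hu h))
      (fun h => n3 (hu h)) h1 h2 ((hT i hi).trans (hT j hj).symm) ((hT i hi).trans (hT l hl).symm)
  have e1 := hne a ha b hb hab
  have e2 := hne a ha c hcT hac
  have e3 := hne b hb c hcT hbc
  rcases lt_or_gt_of_ne e1 with h1 | h1 <;> rcases lt_or_gt_of_ne e2 with h2 | h2 <;>
    rcases lt_or_gt_of_ne e3 with h3 | h3 <;>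
    first
    | exact key a ha b hb c hcT h1 h3
    | exact key a ha c hcT b hb h2 h3
    | exact key c hcT a ha b hb h2 h1
    | exact key b hb a ha c hcT h1 h2
    | exact key b hb c hcT a ha h3 h2
    | exact key c hcT b hb a ha h3 h1

theorem card_le_of_labelClass_small [Fintype ι] (hk0 : 0 < k)
    (hd : ∀ b < d, ∀ m u, Tail r v (p b) m u → d ≤ b + m) (hv : ∀ x y, r x y → x ≠ v)
    (hu : Function.Injective u)
    (W : ∀ i, CriticalWalk r v p d (u i)) (hE : ∀ i, ∀ b < d, tailLabel r v (p b) ≠ u i)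
    (hk : ∀ i, (labelClass r v (u i)).card < k) :
    Fintype.card ι ≤ (k + 2) * (k + 1) + 2 * (Fintype.card V / k) := by
  classical
  let low : ι → Finset ι := fun i₀ => Finset.univ.filter fun i => (W i).β ≤ (W i₀).β
  let A := (Finset.univ : Finset ι).filter fun i₀ => (low i₀).card < (k + 2) * (k + 1)
  let B := (Finset.univ : Finset ι).filter fun i₀ => ¬ (low i₀).card < (k + 2) * (k + 1)
  have hA : A.card ≤ (k + 2) * (k + 1) := by
    rcases A.eq_empty_or_nonempty with h | h
    · simp [h]
    · obtain ⟨i₀, hi₀, hmax⟩ := A.exists_max_image (fun i => (W i).β) h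
      have h1 : A ⊆ low i₀ := fun i hi => by simpa [low] using hmax i hi
      have h2 := (Finset.mem_filter.1 hi₀).2
      exact (Finset.card_le_card h1).trans h2.le
  have hB : B.card ≤ 2 * (Finset.Ico d (d + Fintype.card V / k)).card := by
    refine Finset.card_le_mul_card_image_of_maps_to (f := fun i => (W i).ℓ) ?_ 2 ?_
    · intro i hi
      have h1 := (Finset.mem_filter.1 hi).2
      have h2 := length_sub_mul_le hv hu W hE hk i (low i)
        (fun j hj => (Finset.mem_filter.1 hj).2) (not_lt.1 h1)
      have h3 := (Nat.le_div_iff_mul_le hk0).2 h2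
      have h4 := (W i).tail.drop (W i).tail.pos (r' := r) (fun j _ hj => ((W i).tail.step j hj).1)
      rw [(W i).start] at h4
      have h5 := hd _ ((W i).b_le.trans_lt (W i).β_lt) _ _ h4
      have h6 := (W i).len
      exact Finset.mem_Ico.2 ⟨by omega, by omega⟩
    · intro n _
      exact card_length_eq_le hv hu W hE n _ fun i hi => (Finset.mem_filter.1 hi).2
  have : A.card + B.card = _ := Finset.card_filter_add_card_filter_not
    (s := (Finset.univ : Finset ι)) (fun i₀ => (low i₀).card < (k + 2) * (k + 1))
  rw [Nat.card_Ico] at hB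
  rw [← Finset.card_univ]
  omega

end CriticalWalk

/-- The bound on the number of critical vertices; the natural choice of `k` is the cube root of
the number of vertices. -/
theorem card_critical_le (hk0 : 0 < k)
    (hd : ∀ b < d, ∀ m u, Tail r v (p b) m u → d ≤ b + m) (hv : ∀ x y, r x y → x ≠ v)
    (U : Finset V)
    (hU : ∀ u ∈ U, (∃ b < d, tailLabel r v (p b) = u ∧ ∃ m u', Tail r v (p b) m u') ∨
      ∃ β < d, ∃ c ℓ, IsCritical r v p β c ℓ u) :
    U.card ≤ 3 * (Fintype.card V / k) + k + (k + 2) * (k + 1) := by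
  classical
  let U₁ := U.filter fun u => k ≤ (labelClass r v u).card
  let U' := U.filter fun u => ¬ k ≤ (labelClass r v u).card
  let E : V → Prop := fun u => ∃ b < d, tailLabel r v (p b) = u ∧ ∃ m u', Tail r v (p b) m u'
  let U₂ := U'.filter E
  let U₃ := U'.filter fun u => ¬ E u
  have h1 : U₁.card ≤ Fintype.card V / k := (Nat.le_div_iff_mul_le hk0).2
    (card_mul_le_of_labelClass (r := r) (v := v) U₁ fun u hu => (Finset.mem_filter.1 hu).2)
  have h2 : U₂.card ≤ k := card_le_of_labels hd U₂
    (fun u hu => not_le.1 (Finset.mem_filter.1 (Finset.mem_filter.1 hu).1).2)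
    (fun u hu => (Finset.mem_filter.1 hu).2)
  have h3 : U₃.card ≤ (k + 2) * (k + 1) + 2 * (Fintype.card V / k) := by
    have hW : ∀ i : U₃, Nonempty (CriticalWalk r v p d i.1) := by
      rintro ⟨u, hu⟩
      obtain ⟨hu', hnE⟩ := Finset.mem_filter.1 hu
      rcases hU u (Finset.mem_filter.1 hu').1 with h | ⟨β, hβ, c, ℓ, h⟩
      · exact absurd h hnE
      · exact exists_criticalWalk hβ h
    have W := fun i => Classical.choice (hW i)
    have := CriticalWalk.card_le_of_labelClass_small (k := k) hk0 hd hv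
      (u := fun i : U₃ => i.1) Subtype.val_injective W ?_ ?_
    · simpa using this
    · rintro ⟨u, hu⟩ b hb hl
      obtain ⟨hu', hnE⟩ := Finset.mem_filter.1 hu
      by_cases ht : ∃ m u', Tail r v (p b) m u'
      · exact hnE ⟨b, hb, hl, ht⟩
      · have hp : tailLabel r v (p b) = p b :=
          dif_neg fun ⟨u', hu'⟩ => ht ⟨_, u', hu'⟩
        have h4 := (W ⟨u, hu⟩).critical.1
        obtain ⟨_, -, _, -, h5⟩ := h4
        exact ht ⟨1, u, (hp.symm.trans hl) ▸ .last h5.pen_adj.1⟩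
    · rintro ⟨u, hu⟩
      exact not_le.1 (Finset.mem_filter.1 (Finset.mem_filter.1 hu).1).2
  have e1 := Finset.card_filter_add_card_filter_not (s := U) (fun u => k ≤ (labelClass r v u).card)
  have e2 := Finset.card_filter_add_card_filter_not (s := U') E
  simp only [U₁, U₂, U₃, U'] at *
  omega

end Counting

/-! ### essential edges of a fault-tolerant structure -/

section Essential

variable {V : Type*}

/-- The edge from `u` to `v` is essential for `v`: for some set `F` of at most two failing edges,
`u` is the only vertex that precedes `v` on shortest walks from `s` to `v`. -/
def IsEssential (H : SimpleGraph V) (s v u : V) : Prop :=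
  s ≠ v ∧ ∃ F : Finset (Sym2 V), F.card ≤ 2 ∧
    ∃ w : (H.deleteEdges (F : Set (Sym2 V))).Walk s u, (H.deleteEdges (F : Set (Sym2 V))).Adj u v ∧
      ∀ (z : V) (w' : (H.deleteEdges (F : Set (Sym2 V))).Walk s z),
        (H.deleteEdges (F : Set (Sym2 V))).Adj z v →
          w.length ≤ w'.length ∧ (w'.length = w.length → z = u)

/-- In a fault-tolerant structure that does not stay one when an edge is deleted, every edge is
essential for one of its ends. -/
theorem exists_isEssential {G H : SimpleGraph V} {s : V} (hH : IsFTBFS 2 G s H) {e : Sym2 V}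
    (he : ¬ IsFTBFS 2 G s (H.deleteEdges {e})) : ∃ v u, IsEssential H s v u ∧ e = s(u, v) := by
  classical
  have hle : H.deleteEdges {e} ≤ G := (SimpleGraph.deleteEdges_le _).trans hH.1
  obtain ⟨F, hF, hc, v, hv⟩ : ∃ F : Finset (Sym2 V), (F : Set (Sym2 V)) ⊆ G.edgeSet ∧ F.card ≤ 2 ∧
      ∃ v : V, ((H.deleteEdges {e}).deleteEdges (F : Set (Sym2 V))).edist s v ≠
        (H.deleteEdges (F : Set (Sym2 V))).edist s v := by
    by_contra hcon
    push Not at hcon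
    exact he ⟨hle, fun F hF hc v => (hcon F hF hc v).trans (hH.2 F hF hc v)⟩
  set K := H.deleteEdges (F : Set (Sym2 V)) with hK
  set K' := (H.deleteEdges {e}).deleteEdges (F : Set (Sym2 V)) with hK'
  have hKK : K' ≤ K := SimpleGraph.deleteEdges_mono (SimpleGraph.deleteEdges_le _)
  have hadj : ∀ a b, K.Adj a b → s(a, b) ≠ e → K'.Adj a b := by
    intro a b hab hne
    simp only [hK, hK', SimpleGraph.deleteEdges_adj, Set.mem_singleton_iff] at hab ⊢
    exact ⟨⟨hab.1, hne⟩, hab.2⟩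
  -- A vertex closest to `s` whose distance changes.
  obtain ⟨t, ht, hmin⟩ := WellFounded.has_min (InvImage.wf (fun t => K.edist s t) wellFounded_lt)
    {t | K'.edist s t ≠ K.edist s t} ⟨v, hv⟩
  have hle' : ∀ a, K.edist s a ≤ K'.edist s a := fun a => SimpleGraph.edist_anti hKK
  have hgood : ∀ a, K.edist s a < K.edist s t → K'.edist s a = K.edist s a := fun a ha => by
    by_contra hcon
    exact hmin a hcon ha
  have hreach : K.edist s t ≠ ⊤ := fun h => ht (by
    have := hle' t
    rw [h, top_le_iff] at this
    rw [h, this])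
  have hst : s ≠ t := by
    rintro rfl
    exact ht (by simp)
  obtain ⟨w, hw⟩ := (SimpleGraph.reachable_of_edist_ne_top hreach).exists_walk_length_eq_edist
  have pre : ∀ (z : V) (w' : K.Walk s z), K.Adj z t → K.edist s t ≤ w'.length + 1 := by
    intro z w' hz
    have := SimpleGraph.edist_le (w'.concat hz)
    simpa using this
  have key : ∀ (z : V) (w' : K.Walk s z), K.Adj z t → (w'.length : ℕ∞) + 1 = K.edist s t →
      s(z, t) = e := by
    intro z w' hz hl
    by_contra hne
    have h1 : K.edist s z < K.edist s t := by
      refine (SimpleGraph.edist_le w').trans_lt ?_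
      rw [← hl]
      exact_mod_cast Nat.lt_succ_self _
    have h2 := hgood z h1
    have h3 : K'.edist s t ≤ K'.edist s z + K'.edist z t := SimpleGraph.edist_triangle
    rw [SimpleGraph.edist_eq_one_iff_adj.2 (hadj _ _ hz hne), h2] at h3
    refine ht (le_antisymm (h3.trans ?_) (hle' t))
    rw [← hl]
    gcongr
    exact SimpleGraph.edist_le w'
  have hnil : ¬ w.Nil := SimpleGraph.Walk.not_nil_of_ne hst
  have hlen : w.dropLast.length + 1 = w.length := SimpleGraph.Walk.length_dropLast_add_one hnil
  have he' := key _ w.dropLast (w.adj_penultimate hnil) (by rw [← hw]; exact_mod_cast hlen)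
  refine ⟨t, w.penultimate, ⟨hst, F, hc, w.dropLast, w.adj_penultimate hnil, fun z w' hz => ?_⟩,
    he'.symm⟩
  have h1 := pre z w' hz
  rw [← hw, ← hlen] at h1
  have h1' : w.dropLast.length + 1 ≤ w'.length + 1 := by exact_mod_cast h1
  refine ⟨by omega, fun e' => ?_⟩
  have h2 := key z w' hz (by rw [e', ← hw]; exact_mod_cast hlen)
  exact Sym2.congr_left.1 (h2.trans he'.symm)

/-- A walk along consecutive vertices of a sequence. -/
theorem exists_walk_of_seq {K : SimpleGraph V} {p : ℕ → V} {a b : ℕ} (hab : a ≤ b)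
    (h : ∀ i, a ≤ i → i < b → K.Adj (p i) (p (i + 1))) :
    ∃ w : K.Walk (p a) (p b), w.length = b - a := by
  induction b, hab using Nat.le_induction with
  | base => exact ⟨.nil, by simp⟩
  | succ b hab ih =>
    obtain ⟨w, hw⟩ := ih fun i h1 h2 => h i h1 (by omega)
    exact ⟨w.concat (h b hab (by omega)), by rw [SimpleGraph.Walk.length_concat, hw]; omega⟩

/-- The steps of walks that leave the shortest path `p 0, …, p d = v` and never return to it
before `v`. -/
def OffPath (H : SimpleGraph V) (p : ℕ → V) (d : ℕ) (v : V) (x y : V) : Prop :=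
  H.Adj x y ∧ x ≠ v ∧ (∀ i < d, y ≠ p i) ∧ ¬ (x = p (d - 1) ∧ y = v)

theorem Tail.exists_walk {G : SimpleGraph V} {r : V → V → Prop} {v : V}
    (hr : ∀ x y, r x y → G.Adj x y) {x u : V} {m : ℕ} (h : Tail r v x m u) :
    ∃ w : G.Walk x v, w.length = m := by
  obtain ⟨w, hw⟩ := h.lift_walk hr
  exact ⟨w.concat (hr _ _ h.pen_adj), by rw [SimpleGraph.Walk.length_concat, hw]⟩

variable [Fintype V] [LinearOrder V]

/-- The vertices `u` whose edge to `v` is essential for `v` are, except for the last vertex before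
`v` on a shortest path `p` from `s` to `v`, critical vertices for the walks off `p`.
If both failing edges are on `p`, then a shortest surviving walk leaves `p` for good at some `p b`,
and `u` is the label of `p b`. Otherwise one failing edge is on `p` and gives the level,
and the other one is the fault. -/
theorem IsEssential.critical {H : SimpleGraph V} {s v u : V} (h : IsEssential H s v u) {p : ℕ → V}
    {d : ℕ} (hd : 0 < d) (h0 : p 0 = s) (hp : p d = v) (hadj : ∀ i < d, H.Adj (p i) (p (i + 1)))
    (hmin : ∀ w : H.Walk s v, d ≤ w.length) (hu : u ≠ p (d - 1)) :
    (∃ b < d, tailLabel (OffPath H p d v) v (p b) = u ∧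
      ∃ m u', Tail (OffPath H p d v) v (p b) m u') ∨
    ∃ β < d, ∃ c ℓ, IsCritical (OffPath H p d v) v p β c ℓ u := by
  classical
  obtain ⟨hsv, F, hF, hw⟩ := h
  set K := H.deleteEdges (F : Set (Sym2 V)) with hK
  obtain ⟨w, huv, hopt⟩ := hw
  have hKH : K ≤ H := SimpleGraph.deleteEdges_le _
  have hKadj : ∀ a b, K.Adj a b ↔ H.Adj a b ∧ s(a, b) ∉ F := by
    intro a b
    simp [hK, SimpleGraph.deleteEdges_adj]
  -- `p` is a shortest path.
  have hinit : ∀ i ≤ d, ∀ q : H.Walk s (p i), i ≤ q.length := by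
    intro i hi q
    obtain ⟨q', hq'⟩ := exists_walk_of_seq (K := H) hi (fun j _ hj => hadj j hj)
    have := hmin ((q.append q').copy rfl hp)
    rw [SimpleGraph.Walk.length_copy, SimpleGraph.Walk.length_append] at this
    omega
  have hinj : ∀ i ≤ d, ∀ j ≤ d, p i = p j → i = j := by
    have : ∀ i ≤ d, ∀ j ≤ d, p i = p j → i ≤ j := by
      intro i hi j hj e
      obtain ⟨q, hq⟩ := exists_walk_of_seq (K := H) (p := p) (Nat.zero_le j)
        (fun k _ hk => hadj k (by omega))
      have := hinit i hi (q.copy h0 e.symm)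
      rw [SimpleGraph.Walk.length_copy] at this
      omega
    intro i hi j hj e
    exact le_antisymm (this i hi j hj e) (this j hj i hi e.symm)
  have hvp : ∀ i < d, v ≠ p i := by
    intro i hi e
    have := hinj i hi.le d le_rfl (e.symm.trans hp.symm)
    omega
  have hoff : ∀ x y, OffPath H p d v x y → ∀ i < d, s(x, y) ≠ s(p i, p (i + 1)) := by
    rintro x y ⟨-, -, h3, h4⟩ i hi e
    rcases Sym2.eq_iff.1 e with ⟨e1, e2⟩ | ⟨-, e2⟩
    · by_cases hi' : i + 1 < d
      · exact h3 _ hi' e2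
      · have hid : i = d - 1 := by omega
        subst hid
        rw [Nat.sub_add_cancel hd, hp] at e2
        exact h4 ⟨e1, e2⟩
    · exact h3 i hi e2
  let rK : V → V → Prop := fun x y => OffPath H p d v x y ∧ s(x, y) ∉ F
  have hrK : ∀ x y, rK x y → K.Adj x y := fun x y h => (hKadj x y).2 ⟨h.1.1, h.2⟩
  have hopt' : ∀ (b m' : ℕ) (u' : V) (q : K.Walk s (p b)), Tail rK v (p b) m' u' →
      w.length + 1 ≤ q.length + m' ∧ (q.length + m' = w.length + 1 → u' = u) := by
    intro b m' u' q ht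
    obtain ⟨q', hq'⟩ := ht.lift_walk hrK
    have := hopt u' (q.append q') (hrK _ _ ht.pen_adj)
    rw [SimpleGraph.Walk.length_append] at this
    exact ⟨by omega, fun e => this.2 (by omega)⟩
  -- The last vertex of `w` on `p`.
  let j₀ := Nat.findGreatest (fun j => ∃ b < d, w.getVert j = p b) w.length
  have hj₀ : j₀ ≤ w.length := Nat.findGreatest_le _
  obtain ⟨b, hb, hjb⟩ : ∃ b < d, w.getVert j₀ = p b :=
    Nat.findGreatest_spec (P := fun j => ∃ b < d, w.getVert j = p b) (Nat.zero_le _)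
      ⟨0, hd, by rw [SimpleGraph.Walk.getVert_zero, h0]⟩
  have hafter : ∀ j, j₀ < j → j ≤ w.length → ∀ i < d, w.getVert j ≠ p i := by
    intro j h1 h2 i hi e
    exact Nat.findGreatest_is_greatest h1 h2 ⟨i, hi, e⟩
  have hnev : ∀ j ≤ w.length, w.getVert j ≠ v := by
    intro j hj e
    rcases j with _ | j
    · rw [SimpleGraph.Walk.getVert_zero] at e
      exact hsv e
    · have h1 := w.adj_getVert_succ (i := j) (by omega)
      rw [e] at h1
      have := (hopt _ (w.take j) h1).1
      rw [SimpleGraph.Walk.take_length] at this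
      omega
  have htail : ∀ t ≤ w.length - j₀, Tail rK v (w.getVert (w.length - t)) (t + 1) u := by
    intro t
    induction t with
    | zero =>
      intro _
      rw [Nat.sub_zero, SimpleGraph.Walk.getVert_length]
      have := (hKadj u v).1 huv
      exact .last ⟨⟨this.1, this.1.ne, hvp, fun h => hu h.1⟩, this.2⟩
    | succ t ih =>
      intro ht
      have h1 := w.adj_getVert_succ (i := w.length - (t + 1)) (by omega)
      rw [show w.length - (t + 1) + 1 = w.length - t by omega] at h1
      have h2 := (hKadj _ _).1 h1
      exact .cons ⟨⟨h2.1, hnev _ (by omega), hafter _ (by omega) (by omega),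
        fun h => hnev _ (by omega) h.2⟩, h2.2⟩ (ih (by omega))
  have ht := htail (w.length - j₀) le_rfl
  rw [show w.length - (w.length - j₀) = j₀ by omega, hjb] at ht
  have hq : (w.take j₀).length = j₀ := by rw [SimpleGraph.Walk.take_length]; omega
  -- Some edge of `p` after `p b` fails.
  obtain ⟨i, hbi, hid, hiF⟩ : ∃ i, b ≤ i ∧ i < d ∧ s(p i, p (i + 1)) ∈ F := by
    by_contra hcon
    push Not at hcon
    obtain ⟨q, hq'⟩ := exists_walk_of_seq (K := K) (p := p) (a := b) (b := d - 1) (by omega)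
      (fun i h1 h2 => (hKadj _ _).2 ⟨hadj i (by omega), hcon i h1 (by omega)⟩)
    have hl : K.Adj (p (d - 1)) v := by
      have h1 := (hKadj _ _).2 ⟨hadj (d - 1) (by omega), hcon (d - 1) (by omega) (by omega)⟩
      rwa [Nat.sub_add_cancel hd, hp] at h1
    have h2 := hopt _ (((w.take j₀).copy rfl hjb).append q) hl
    rw [SimpleGraph.Walk.length_append, SimpleGraph.Walk.length_copy, hq, hq'] at h2
    obtain ⟨q'', hq''⟩ := ht.exists_walk (G := H) (fun x y h => h.1.1)
    obtain ⟨q₀, hq₀⟩ := exists_walk_of_seq (K := H) (p := p) (Nat.zero_le b)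
      (fun k _ hk => hadj k (by omega))
    have h3 := hmin ((q₀.copy h0 rfl).append q'')
    rw [SimpleGraph.Walk.length_append, SimpleGraph.Walk.length_copy] at h3
    exact hu (h2.2 (by omega)).symm
  have hwb : ∀ m' u', Tail rK v (p b) m' u' →
      w.length + 1 ≤ j₀ + m' ∧ (j₀ + m' = w.length + 1 → u' = u) := by
    intro m' u' h
    have := hopt' b m' u' ((w.take j₀).copy rfl hjb) h
    rwa [SimpleGraph.Walk.length_copy, hq] at this
  by_cases hcase : ∃ c ∈ F, ∀ k < d, c ≠ s(p k, p (k + 1))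
  · right
    obtain ⟨c, hcF, hc⟩ := hcase
    have hFeq : ∀ e, e ∈ F ↔ e = s(p i, p (i + 1)) ∨ e = c := by
      have hsub : {s(p i, p (i + 1)), c} ⊆ F := by
        intro e he
        rw [Finset.mem_insert, Finset.mem_singleton] at he
        rcases he with rfl | rfl
        · exact hiF
        · exact hcF
      have := Finset.eq_of_subset_of_card_le hsub (by
        rw [Finset.card_pair (hc i hid).symm]; exact hF)
      intro e
      rw [← this, Finset.mem_insert, Finset.mem_singleton]
    have hup : ∀ x y, Avoid (OffPath H p d v) c x y → rK x y := by
      intro x y h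
      refine ⟨h.1, fun hm => ?_⟩
      rcases (hFeq _).1 hm with e | e
      · exact hoff x y h.1 i hid e
      · exact h.2 e
    have hdown : ∀ x y, rK x y → Avoid (OffPath H p d v) c x y :=
      fun x y h => ⟨h.1, fun e => h.2 (e ▸ hcF)⟩
    have hbest : ∀ ℓ' u', Available (OffPath H p d v) v p i c ℓ' u' →
        w.length + 1 ≤ ℓ' ∧ (ℓ' = w.length + 1 → u' = u) := by
      rintro ℓ' u' ⟨b', hb', m', rfl, ht'⟩
      obtain ⟨q, hq'⟩ := exists_walk_of_seq (K := K) (p := p) (Nat.zero_le b') (fun k _ hk => by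
        refine (hKadj _ _).2 ⟨hadj k (by omega), fun hm => ?_⟩
        rcases (hFeq _).1 hm with e | e
        · rcases Sym2.eq_iff.1 e with ⟨e, -⟩ | ⟨e, -⟩
          · have := hinj k (by omega) i (by omega) e
            omega
          · have := hinj k (by omega) (i + 1) (by omega) e
            omega
        · exact hc k (by omega) e.symm)
      have := hopt' b' m' u' (q.copy h0 rfl) (ht'.mono hup)
      rwa [SimpleGraph.Walk.length_copy, hq', Nat.sub_zero] at this
    have hjb' := hinit b hb.le (((w.take j₀).copy rfl hjb).mapLe hKH)
    rw [SimpleGraph.Walk.length_map, SimpleGraph.Walk.length_copy, hq] at hjb'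
    have hav : Available (OffPath H p d v) v p i c (b + (w.length - j₀ + 1)) u :=
      ⟨b, hbi, _, rfl, ht.mono hdown⟩
    have h1 := hbest _ _ hav
    rw [show b + (w.length - j₀ + 1) = w.length + 1 by omega] at hav
    exact ⟨i, hid, c, _, hav, hbest⟩
  · left
    push Not at hcase
    have hup : ∀ x y, OffPath H p d v x y → rK x y := by
      intro x y h
      refine ⟨h, fun hm => ?_⟩
      obtain ⟨k, hk, e⟩ := hcase _ hm
      exact hoff x y h k hk e
    have ht' : Tail (OffPath H p d v) v (p b) (w.length - j₀ + 1) u := ht.mono fun x y h => h.1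
    refine ⟨b, hb, ?_, _, _, ht'⟩
    have h1 := hwb _ _ ((tail_tailLabel ht').mono hup)
    have h2 := tailDist_le ht'
    exact h1.2 (by omega)

/-- For each vertex `v`, few edges are essential for `v`. -/
theorem card_isEssential_le (H : SimpleGraph V) (s v : V) {k : ℕ} (hk : 0 < k) (U : Finset V)
    (hU : ∀ u ∈ U, IsEssential H s v u) :
    U.card ≤ 3 * (Fintype.card V / k) + k + (k + 2) * (k + 1) + 1 := by
  classical
  rcases U.eq_empty_or_nonempty with rfl | ⟨u₀, hu₀⟩
  · simp
  obtain ⟨hsv, F, -, w, hadj, -⟩ := hU u₀ hu₀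
  have hreach : H.Reachable s v :=
    ⟨(w.concat hadj).mapLe (SimpleGraph.deleteEdges_le _)⟩
  obtain ⟨q, hq⟩ := hreach.exists_walk_length_eq_dist
  have hd : 0 < q.length := by
    rw [hq]
    exact hreach.pos_dist_of_ne hsv
  have hmin : ∀ q' : H.Walk s v, q.length ≤ q'.length := fun q' => hq ▸ SimpleGraph.dist_le q'
  set d := q.length with hdq
  set p := q.getVert with hp
  have h0 : p 0 = s := q.getVert_zero
  have hpd : p d = v := q.getVert_length
  have hpadj : ∀ i < d, H.Adj (p i) (p (i + 1)) := fun i hi => q.adj_getVert_succ hi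
  have h1 := card_critical_le (r := OffPath H p d v) (v := v) (p := p) (d := d) hk ?_
    (fun x y h => h.2.1) (U.erase (p (d - 1))) ?_
  · have := Finset.pred_card_le_card_erase (s := U) (a := p (d - 1))
    omega
  · intro b hb m u ht
    obtain ⟨w', hw'⟩ := ht.exists_walk (G := H) fun x y h => h.1
    have h2 := hmin ((q.take b).append w')
    rw [SimpleGraph.Walk.length_append, SimpleGraph.Walk.take_length, hw'] at h2
    omega
  · intro u hu
    rw [Finset.mem_erase] at hu
    exact (hU u hu.2).critical hd h0 hpd hpadj hmin hu.1

/-- A fault-tolerant structure that is minimal under deletion of an edge has few edges. -/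
theorem ncard_edgeSet_le {G H : SimpleGraph V} {s : V} (hH : IsFTBFS 2 G s H)
    (hmin : ∀ e ∈ H.edgeSet, ¬ IsFTBFS 2 G s (H.deleteEdges {e})) {k : ℕ} (hk : 0 < k) :
    H.edgeSet.ncard ≤
      Fintype.card V * (3 * (Fintype.card V / k) + k + (k + 2) * (k + 1) + 1) := by
  classical
  let U : V → Finset V := fun v => Finset.univ.filter fun u => IsEssential H s v u
  let E : Finset (Sym2 V) := Finset.univ.biUnion fun v => (U v).image fun u => s(u, v)
  have hsub : H.edgeSet ⊆ (E : Set (Sym2 V)) := by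
    intro e he
    obtain ⟨v, u, h, rfl⟩ := exists_isEssential hH (hmin e he)
    simp only [E, Finset.mem_coe, Finset.mem_biUnion, Finset.mem_image]
    exact ⟨v, Finset.mem_univ _, u, by simpa [U] using h, rfl⟩
  calc H.edgeSet.ncard ≤ (E : Set (Sym2 V)).ncard := Set.ncard_le_ncard hsub E.finite_toSet
    _ = E.card := Set.ncard_coe_finset E
    _ ≤ ∑ v, ((U v).image fun u => s(u, v)).card := Finset.card_biUnion_le
    _ ≤ ∑ _v : V, (3 * (Fintype.card V / k) + k + (k + 2) * (k + 1) + 1) := by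
        refine Finset.sum_le_sum fun v _ => Finset.card_image_le.trans ?_
        exact card_isEssential_le H s v hk (U v) fun u hu => (Finset.mem_filter.1 hu).2
    _ = _ := by simp

end Essential

/-- With `k` the cube root of `n`, rounded up, the bound on the number of edges is
`O(n ^ (5 / 3))`. -/
theorem edge_bound_le {n : ℕ} (hn : 0 < n) : ∃ k : ℕ, 0 < k ∧
    ((n * (3 * (n / k) + k + (k + 2) * (k + 1) + 1) : ℕ) : ℝ) ≤ 30 * (n : ℝ) ^ ((5 : ℝ) / 3) := by
  have hn' : (1 : ℝ) ≤ n := by exact_mod_cast hn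
  set x : ℝ := (n : ℝ) ^ ((1 : ℝ) / 3) with hx
  have hx1 : 1 ≤ x := Real.one_le_rpow hn' (by norm_num)
  have hx3 : x ^ 3 = n := by
    rw [hx, ← Real.rpow_natCast, ← Real.rpow_mul (by positivity)]
    norm_num
  have hx5 : (n : ℝ) ^ ((5 : ℝ) / 3) = x ^ 5 := by
    rw [hx, ← Real.rpow_natCast, ← Real.rpow_mul (by positivity)]
    norm_num
  refine ⟨⌈x⌉₊, Nat.ceil_pos.2 (by linarith), ?_⟩
  set k := ⌈x⌉₊
  have hk1 : x ≤ k := Nat.le_ceil x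
  have hk2 : (k : ℝ) ≤ 2 * x := by
    have := Nat.ceil_lt_add_one (show 0 ≤ x by linarith)
    linarith
  have hdiv : ((n / k : ℕ) : ℝ) ≤ x ^ 2 := by
    refine Nat.cast_div_le.trans ?_
    rw [div_le_iff₀ (by linarith), ← hx3]
    nlinarith [sq_nonneg x]
  push_cast
  rw [hx5]
  have hb : 3 * ((n / k : ℕ) : ℝ) + k + (k + 2) * (k + 1) + 1 ≤ 30 * x ^ 2 := by
    nlinarith
  calc (n : ℝ) * (3 * ((n / k : ℕ) : ℝ) + k + (k + 2) * (k + 1) + 1) ≤ n * (30 * x ^ 2) := by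
        gcongr
    _ = 30 * x ^ 5 := by rw [← hx3]; ring

/-! ### a time-bounded program logic -/

namespace RAM

/-- Started in state `σ`, the program `p` halts within time `T` in a state that satisfies `Q`. -/
def Runs (p : Prog) (σ : State) (T : ℕ) (Q : State → Prop) : Prop :=
  ∃ t τ, Exec p σ t τ ∧ t ≤ T ∧ Q τ

theorem Runs.mono {p : Prog} {σ : State} {T T' : ℕ} {Q Q' : State → Prop} (h : Runs p σ T Q)
    (hT : T ≤ T') (hQ : ∀ τ, Q τ → Q' τ) : Runs p σ T' Q' := by
  obtain ⟨t, τ, h1, h2, h3⟩ := h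
  exact ⟨t, τ, h1, h2.trans hT, hQ τ h3⟩

theorem Runs.skip {σ : State} {T : ℕ} {Q : State → Prop} (hT : 1 ≤ T) (h : Q σ) :
    Runs .skip σ T Q :=
  ⟨1, σ, .skip σ, hT, h⟩

theorem Runs.set {σ : State} {x : ℕ} {e : Exp} {T : ℕ} {Q : State → Prop} (hT : e.cost + 1 ≤ T)
    (h : Q (σ.setReg x (e.eval σ))) : Runs (.set x e) σ T Q :=
  ⟨_, _, .set σ x e, hT, h⟩

theorem Runs.put {σ : State} {a : ℕ} {i e : Exp} {T : ℕ} {Q : State → Prop}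
    (hT : i.cost + e.cost + 1 ≤ T) (h : Q (σ.setArr a (i.eval σ) (e.eval σ))) :
    Runs (.put a i e) σ T Q :=
  ⟨_, _, .put σ a i e, hT, h⟩

theorem Runs.seq {p q : Prog} {σ : State} (T₁ T₂ : ℕ) {T : ℕ} {Q : State → Prop}
    (hT : T₁ + T₂ ≤ T) (h : Runs p σ T₁ fun τ => Runs q τ T₂ Q) : Runs (.seq p q) σ T Q := by
  obtain ⟨t, τ, h1, h2, u, ρ, h3, h4, h5⟩ := h
  exact ⟨_, ρ, .seq h1 h3, (Nat.add_le_add h2 h4).trans hT, h5⟩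

theorem Runs.ite {e : Exp} {p q : Prog} {σ : State} (T₁ : ℕ) {T : ℕ} {Q : State → Prop}
    (hT : e.cost + T₁ + 1 ≤ T) (h1 : e.eval σ ≠ 0 → Runs p σ T₁ Q)
    (h2 : e.eval σ = 0 → Runs q σ T₁ Q) : Runs (.ite e p q) σ T Q := by
  by_cases h : e.eval σ = 0
  · obtain ⟨t, τ, h3, h4, h5⟩ := h2 h
    exact ⟨_, τ, .ite_false h h3, by omega, h5⟩
  · obtain ⟨t, τ, h3, h4, h5⟩ := h1 h
    exact ⟨_, τ, .ite_true h h3, by omega, h5⟩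

/-- `for x := 0, …, e - 1 do p`. -/
def forUp (x : ℕ) (e : Exp) (p : Prog) : Prog :=
  .seq (.set x (.lit 0))
    (.loop (.lt (.var x) e) (.seq p (.set x (.add (.var x) (.lit 1)))))

/-- A time bound for a loop with `N` rounds and time `T` for the body of the loop; it is stated
in any semiring so that it can be evaluated at numbers and at polynomials. -/
def loopTime {R : Type*} [Semiring R] (N T : R) : R := N * (T + 10) + 8

/-- The rule for loops with the invariant `I`. -/
theorem Runs.forUp {x : ℕ} {e : Exp} {p : Prog} {σ : State} {N T : ℕ} (I : ℕ → State → Prop)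
    (he : e.cost ≤ 3) (h0 : I 0 (σ.setReg x 0))
    (hI : ∀ i ≤ N, ∀ τ, I i τ → τ.reg x = i ∧ e.eval τ = N)
    (hp : ∀ i < N, ∀ τ, I i τ → Runs p τ T fun τ' =>
      τ'.reg x = i ∧ I (i + 1) (τ'.setReg x (i + 1))) :
    Runs (forUp x e p) σ (loopTime N T) (I N) := by
  have key : ∀ k i τ, i + k = N → I i τ →
      Runs (.loop (.lt (.var x) e) (.seq p (.set x (.add (.var x) (.lit 1))))) τ
        (k * (T + 10) + 6) (I N) := by
    intro k
    induction k with
    | zero =>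
      rintro i τ rfl h
      obtain ⟨h1, h2⟩ := hI _ le_rfl τ h
      refine ⟨_, τ, .loop_false ?_, ?_, h⟩
      · simp [Exp.eval, h1, h2]
      · simp only [Exp.cost]
        omega
    | succ k ih =>
      intro i τ hk h
      obtain ⟨h1, h2⟩ := hI i (by omega) τ h
      obtain ⟨t, τ', e1, e2, e3, e4⟩ := hp i (by omega) τ h
      obtain ⟨t', ρ, f1, f2, f3⟩ := ih (i + 1) _ (by omega) e4
      have h3 : (Exp.lt (.var x) e).eval τ ≠ 0 := by
        simp only [Exp.eval, h1, h2]
        rw [if_pos (by omega)]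
        exact one_ne_zero
      have h4 : Exec (.set x (.add (.var x) (.lit 1))) τ' _ _ := .set τ' x _
      simp only [Exp.eval, e3] at h4
      refine ⟨_, ρ, .loop_true h3 (.seq e1 h4) f1, ?_, f3⟩
      simp only [Exp.cost]
      rw [Nat.succ_mul]
      omega
  obtain ⟨t, τ, e1, e2, e3⟩ := key N 0 _ (by omega) h0
  refine ⟨_, τ, .seq (.set σ x _) e1, ?_, e3⟩
  simp only [Exp.cost, loopTime]
  omega

end RAM

/-! ### testing fault tolerance by balls -/

section Balls

variable {V : Type*}

/-- The set `R` together with the neighbours of its elements. -/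
def ballStep (K : SimpleGraph V) (R : V → Prop) (v : V) : Prop := R v ∨ ∃ u, R u ∧ K.Adj u v

/-- The ball of radius `j` around `s`. -/
def ball (K : SimpleGraph V) (s : V) : ℕ → V → Prop
  | 0 => fun v => v = s
  | j + 1 => ballStep K (ball K s j)

theorem ball_iff {K : SimpleGraph V} {s : V} {j : ℕ} {v : V} : ball K s j v ↔ K.edist s v ≤ j := by
  induction j generalizing v with
  | zero =>
    simp only [ball, Nat.cast_zero, nonpos_iff_eq_zero, SimpleGraph.edist_eq_zero_iff]
    exact eq_comm
  | succ j ih =>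
    simp only [ball, ballStep, ih]
    constructor
    · rintro (h | ⟨u, h, hadj⟩)
      · exact h.trans (by exact_mod_cast Nat.le_succ j)
      · have h1 : K.edist s v ≤ K.edist s u + K.edist u v := SimpleGraph.edist_triangle
        rw [SimpleGraph.edist_eq_one_iff_adj.2 hadj] at h1
        push_cast
        exact h1.trans (by gcongr)
    · intro h
      have hr : K.edist s v ≠ ⊤ := ne_top_of_le_ne_top (ENat.natCast_ne_top _) h
      obtain ⟨w, hw⟩ := (SimpleGraph.reachable_of_edist_ne_top hr).exists_walk_length_eq_edist
      by_cases hn : w.Nil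
      · left
        rw [← hw, SimpleGraph.Walk.length_eq_zero_iff.2 hn]
        simp
      · refine .inr ⟨_, (SimpleGraph.edist_le w.dropLast).trans ?_, w.adj_penultimate hn⟩
        rw [← hw, ← SimpleGraph.Walk.length_dropLast_add_one hn] at h
        have : w.dropLast.length + 1 ≤ j + 1 := by exact_mod_cast h
        exact_mod_cast (by omega : w.dropLast.length ≤ j)

/-- A subgraph has the same distances from `s` as soon as it extends the balls in the same way. -/
theorem forall_ballStep_iff [Fintype V] {K K' : SimpleGraph V} {s : V} {N : ℕ}
    (hN : Fintype.card V ≤ N) :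
    (∀ j < N, ∀ v, ballStep K (ball K s j) v ↔ ballStep K' (ball K s j) v) ↔
      ∀ v, K'.edist s v = K.edist s v := by
  classical
  constructor
  · intro h
    have hball : ∀ j ≤ N, ball K s j = ball K' s j := by
      intro j
      induction j with
      | zero => intro _; rfl
      | succ j ih =>
        intro hj
        rw [ball, ball, ← ih (by omega)]
        exact funext fun v => propext (h j (by omega) v)
    have hle : ∀ j ≤ N, ∀ v, K.edist s v ≤ j ↔ K'.edist s v ≤ j := by
      intro j hj v
      rw [← ball_iff, ← ball_iff, hball j hj]
    have hbound : ∀ (L : SimpleGraph V) (v : V), L.edist s v ≠ ⊤ →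
        ∃ j ≤ N, L.edist s v = (j : ℕ) := by
      intro L v hv
      obtain ⟨w⟩ := SimpleGraph.reachable_of_edist_ne_top hv
      refine ⟨(L.edist s v).toNat, ?_, (ENat.natCast_toNat hv).symm⟩
      have h1 := (SimpleGraph.edist_le w.bypass)
      have h2 := (w.bypass_isPath).length_lt
      have h3 := ENat.toNat_le_toNat h1 (ENat.natCast_ne_top _)
      rw [ENat.toNat_natCast] at h3
      omega
    intro v
    by_cases h1 : K.edist s v = ⊤
    · by_contra h2
      rw [h1] at h2
      obtain ⟨j, hj, e⟩ := hbound K' v h2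
      have := (hle j hj v).2 e.le
      rw [h1, top_le_iff] at this
      exact ENat.natCast_ne_top _ this
    · obtain ⟨j, hj, e⟩ := hbound K v h1
      have h2 := (hle j hj v).1 e.le
      obtain ⟨j', hj', e'⟩ := hbound K' v (ne_top_of_le_ne_top (ENat.natCast_ne_top _) h2)
      have h3 := (hle j' hj' v).2 e'.le
      rw [e] at h3 ⊢
      rw [e'] at h2 ⊢
      exact le_antisymm h2 h3
  · intro h j _ v
    have hball : ∀ j, ball K s j = ball K' s j := by
      intro j
      funext v
      rw [eq_iff_iff, ball_iff, ball_iff, h]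
    have h1 := congrFun (hball (j + 1)) v
    rw [ball, ball, ← hball j] at h1
    rw [h1]

/-- Fault tolerance in terms of all pairs of vertex pairs: pairs that are not edges do no harm. -/
theorem isFTBFS_two_iff {G H : SimpleGraph V} {s : V} (hH : H ≤ G) :
    IsFTBFS 2 G s H ↔ ∀ a b c d v : V, (H.deleteEdges {s(a, b), s(c, d)}).edist s v =
      (G.deleteEdges {s(a, b), s(c, d)}).edist s v := by
  classical
  have hcongr : ∀ {K : SimpleGraph V} (_ : K ≤ G) {S T : Set (Sym2 V)},
      (∀ e ∈ G.edgeSet, e ∈ S ↔ e ∈ T) → K.deleteEdges S = K.deleteEdges T := by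
    intro K hK S T h
    ext a b
    simp only [SimpleGraph.deleteEdges_adj]
    exact and_congr_right fun hab => not_congr (h _ (hK hab))
  constructor
  · rintro ⟨-, h⟩ a b c d v
    have h1 := h (({s(a, b), s(c, d)} : Finset (Sym2 V)).filter (· ∈ G.edgeSet))
      (fun e he => (Finset.mem_filter.1 he).2)
      ((Finset.card_filter_le _ _).trans Finset.card_le_two) v
    have h2 : ∀ e ∈ G.edgeSet, e ∈ (({s(a, b), s(c, d)} : Finset (Sym2 V)).filter
        (· ∈ G.edgeSet) : Set (Sym2 V)) ↔ e ∈ ({s(a, b), s(c, d)} : Set (Sym2 V)) := by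
      intro e he
      simp [he]
    rwa [hcongr hH h2, hcongr le_rfl h2] at h1
  · intro h
    refine ⟨hH, fun F hF hc v => ?_⟩
    obtain ⟨e₁, e₂, he⟩ : ∃ e₁ e₂ : Sym2 V, ∀ e ∈ G.edgeSet,
        e ∈ (F : Set (Sym2 V)) ↔ e ∈ ({e₁, e₂} : Set (Sym2 V)) := by
      rcases F.eq_empty_or_nonempty with rfl | ⟨e₁, h₁⟩
      · refine ⟨s(s, s), s(s, s), fun e he => ?_⟩
        simp only [Finset.coe_empty, Set.mem_empty_iff_false, Set.mem_insert_iff,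
          Set.mem_singleton_iff, or_self, false_iff]
        rintro rfl
        exact G.loopless.irrefl s he
      · rcases (F.erase e₁).eq_empty_or_nonempty with h' | ⟨e₂, h₂⟩
        · refine ⟨e₁, e₁, fun e _ => ?_⟩
          have : F = {e₁} := by
            rw [← Finset.insert_erase h₁, h']
            rfl
          simp [this]
        · refine ⟨e₁, e₂, fun e _ => ?_⟩
          have hne := (Finset.mem_erase.1 h₂).1
          have hsub : ({e₁, e₂} : Finset (Sym2 V)) ⊆ F := by
            intro e he
            rw [Finset.mem_insert, Finset.mem_singleton] at he
            rcases he with rfl | rfl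
            · exact h₁
            · exact (Finset.mem_erase.1 h₂).2
          rw [← Finset.eq_of_subset_of_card_le hsub (by rwa [Finset.card_pair hne.symm])]
          simp
    induction e₁ using Sym2.ind with | _ a b =>
    induction e₂ using Sym2.ind with | _ c d =>
    rw [hcongr hH he, hcongr le_rfl he]
    exact h a b c d v

theorem IsFTBFS.of_le {f : ℕ} {G H H' : SimpleGraph V} {s : V} (h : IsFTBFS f G s H) (hH : H ≤ H')
    (hG : H' ≤ G) : IsFTBFS f G s H' := by
  refine ⟨hG, fun F hF hc v => le_antisymm ?_ ?_⟩
  · rw [← h.2 F hF hc v]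
    exact SimpleGraph.edist_anti (SimpleGraph.deleteEdges_mono hH)
  · exact SimpleGraph.edist_anti (SimpleGraph.deleteEdges_mono hG)

end Balls

/-! ### the program and its parts -/

namespace RAM

/-- The expression `u * n + v`, with the multiples of `n` looked up in array `2`. -/
def cell (u v : ℕ) : Exp := .add (.get 2 (.var u)) (.var v)

/-- Neither `(u, v)` nor `(v, u)` is one of the two pairs in the registers `7` and `8`. The vertices
`u` and `v` are in the registers `11` and `10`. -/
def survives : Exp :=
  .eq (.add (.add (.eq (cell 11 10) (.var 7)) (.eq (cell 10 11) (.var 7)))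
    (.add (.eq (cell 11 10) (.var 8)) (.eq (cell 10 11) (.var 8)))) (.lit 0)

/-- Is vertex `10` the neighbour of some vertex in the current ball: register `12` answers
this in `G`, register `13` in `H`, both without the failing edges. -/
def scanBody : Prog :=
  .ite (.get 3 (cell 9 11))
    (.ite survives
      (.seq (.ite (.get 0 (cell 11 10)) (.set 12 (.lit 1)) .skip)
        (.ite (.get 1 (cell 11 10)) (.set 13 (.lit 1)) .skip)) .skip) .skip

/-- Extend the ball in row `9` of array `3` by vertex `10` if appropriate, and clear register `6`
if the answers in `G` and `H` differ. -/
def extendBody : Prog :=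
  .seq (.set 12 (.get 3 (cell 9 10)))
    (.seq (.set 13 (.var 12))
      (.seq (forUp 11 (.var 0) scanBody)
        (.seq (.put 3 (.add (.get 2 (.add (.var 9) (.lit 1))) (.var 10)) (.var 12))
          (.ite (.eq (.var 12) (.var 13)) .skip (.set 6 (.lit 0))))))

/-- Compare the distances from `s` in `G` and in `H` without the failing edges. -/
def compareProg : Prog :=
  .seq (forUp 10 (.var 0) (.put 3 (.var 10) (.eq (.var 10) (.var 1))))
    (forUp 9 (.var 0) (forUp 10 (.var 0) extendBody))

/-- Register `6` records whether `H` is fault-tolerant. -/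
def testProg : Prog :=
  .seq (.set 6 (.lit 1)) (forUp 7 (.get 2 (.var 0)) (forUp 8 (.get 2 (.var 0)) compareProg))

/-- Delete the edge between the vertices in the registers `3` and `4` from `H` if `H` stays
fault-tolerant. -/
def reduceBody : Prog :=
  .seq (.set 5 (.get 1 (cell 3 4)))
    (.seq (.put 1 (cell 3 4) (.lit 0))
      (.seq (.put 1 (cell 4 3) (.lit 0))
        (.seq testProg
          (.ite (.var 6) .skip
            (.seq (.put 1 (cell 3 4) (.var 5)) (.put 1 (cell 4 3) (.var 5)))))))

/-- Tabulate the multiples of `n` in array `2`. -/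
def multiplesProg : Prog :=
  forUp 2 (.add (.var 0) (.lit 1))
    (.seq (.put 2 (.var 2) (.var 14)) (.set 14 (.add (.var 14) (.var 0))))

/-- Copy the adjacency matrix. -/
def copyProg : Prog :=
  forUp 3 (.var 0) (forUp 4 (.var 0) (.put 1 (cell 3 4) (.get 0 (cell 3 4))))

/-- Delete edges greedily from a copy `H` of `G` as long as `H` stays fault-tolerant. -/
def greedyProg : Prog :=
  .seq multiplesProg (.seq copyProg (forUp 3 (.var 0) (forUp 4 (.var 0) reduceBody)))

/-! ### running times -/

section Times

variable {R : Type*} [Semiring R]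

/-- Time bound for `extendBody`. -/
def extendTime (n : R) : R := loopTime n 60 + 40

/-- Time bound for `compareProg`. -/
def compareTime (n : R) : R := loopTime n 20 + loopTime n (loopTime n (extendTime n))

/-- Time bound for `testProg`. -/
def testTime (n : R) : R := 5 + loopTime (n * n) (loopTime (n * n) (compareTime n))

/-- Time bound for `greedyProg`. -/
def greedyTime (n : R) : R :=
  loopTime (n + 1) 20 + (loopTime n (loopTime n 20) + loopTime n (loopTime n (testTime n + 60)))

end Times

theorem eval_greedyTime (n : ℕ) :
    (greedyTime (Polynomial.X : Polynomial ℕ)).eval n = greedyTime n := by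
  simp [greedyTime, testTime, compareTime, extendTime, loopTime]

/-! ### states and invariants -/

open Classical in
/-- The truth value of a proposition as a number. -/
noncomputable def bit (P : Prop) : ℕ := if P then 1 else 0

theorem bit_true {P : Prop} (h : P) : bit P = 1 := if_pos h

theorem bit_false {P : Prop} (h : ¬ P) : bit P = 0 := if_neg h

theorem bit_ne_zero {P : Prop} : bit P ≠ 0 ↔ P := by
  by_cases h : P <;> simp [bit, h]

theorem bit_eq_zero {P : Prop} : bit P = 0 ↔ ¬ P := by
  by_cases h : P <;> simp [bit, h]

theorem bit_inj {P Q : Prop} : bit P = bit Q ↔ (P ↔ Q) := by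
  by_cases h : P <;> by_cases h' : Q <;> simp [bit, h, h']

variable {n : ℕ}

theorem code_inj {u v u' v' : Fin n} :
    (u : ℕ) * n + v = (u' : ℕ) * n + v' ↔ u = u' ∧ v = v' := by
  constructor
  · intro h
    have hn : 0 < n := by have := u.2; omega
    have h1 : ((u : ℕ) * n + v) / n = u := by
      rw [mul_comm, Nat.mul_add_div hn, Nat.div_eq_of_lt v.2, Nat.add_zero]
    have h2 : ((u' : ℕ) * n + v') / n = u' := by
      rw [mul_comm, Nat.mul_add_div hn, Nat.div_eq_of_lt v'.2, Nat.add_zero]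
    have h3 : (u : ℕ) = u' := by rw [← h1, ← h2, h]
    rw [h3] at h
    exact ⟨Fin.ext h3, Fin.ext (by omega)⟩
  · rintro ⟨rfl, rfl⟩
    rfl

theorem exists_code {f : ℕ} (hf : f < n * n) : ∃ a b : Fin n, f = (a : ℕ) * n + b := by
  have hn : 0 < n := Nat.pos_of_ne_zero (by rintro rfl; simp at hf)
  refine ⟨⟨f / n, Nat.div_lt_of_lt_mul hf⟩, ⟨f % n, Nat.mod_lt _ hn⟩, ?_⟩
  rw [mul_comm]
  exact (Nat.div_add_mod f n).symm

theorem code_lt (a b : Fin n) : (a : ℕ) * n + b < n * n := by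
  have h1 : ((a : ℕ) + 1) * n ≤ n * n := Nat.mul_le_mul_right n a.2
  rw [Nat.succ_mul] at h1
  have := b.2
  omega

/-- The registers and arrays that describe the input, the current subgraph `H` and the multiples
of `n`. -/
structure Env (G H : SimpleGraph (Fin n)) (s : Fin n) (σ : State) : Prop where
  reg0 : σ.reg 0 = n
  reg1 : σ.reg 1 = s
  arr0 : ∀ u v : Fin n, σ.arr 0 ((u : ℕ) * n + v) = bit (G.Adj u v)
  arr1 : ∀ u v : Fin n, σ.arr 1 ((u : ℕ) * n + v) = bit (H.Adj u v)
  arr2 : ∀ i ≤ n, σ.arr 2 i = i * n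

/-- The states agree in the registers below `k`, except for the flag in register `6`, and in the
arrays `0`, `1` and `2`. -/
structure Same (k : ℕ) (σ τ : State) : Prop where
  reg : ∀ x < k, x ≠ 6 → τ.reg x = σ.reg x
  arr : ∀ a < 3, τ.arr a = σ.arr a

theorem Same.refl (k : ℕ) (σ : State) : Same k σ σ := ⟨fun _ _ _ => rfl, fun _ _ => rfl⟩

theorem Same.trans {k : ℕ} {σ τ ρ : State} (h : Same k σ τ) (h' : Same k τ ρ) : Same k σ ρ :=
  ⟨fun x hx hx' => (h'.reg x hx hx').trans (h.reg x hx hx'),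
    fun a ha => (h'.arr a ha).trans (h.arr a ha)⟩

theorem Same.mono {k k' : ℕ} {σ τ : State} (h : Same k σ τ) (hk : k' ≤ k) : Same k' σ τ :=
  ⟨fun x hx hx' => h.reg x (hx.trans_le hk) hx', h.arr⟩

theorem Same.setReg {k : ℕ} {σ τ : State} (h : Same k σ τ) {x : ℕ} (hx : k ≤ x ∨ x = 6) (m : ℕ) :
    Same k σ (τ.setReg x m) := by
  refine ⟨fun y hy hy' => ?_, h.arr⟩
  have : y ≠ x := by omega
  simp only [State.setReg, Function.update_of_ne this]
  exact h.reg y hy hy'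

theorem Same.setArr {k : ℕ} {σ τ : State} (h : Same k σ τ) (i m : ℕ) :
    Same k σ (τ.setArr 3 i m) := by
  refine ⟨h.reg, fun a ha => ?_⟩
  have : a ≠ 3 := by omega
  simp only [State.setArr, Function.update_of_ne this]
  exact h.arr a ha

theorem Env.of_same {G H : SimpleGraph (Fin n)} {s : Fin n} {σ τ : State} (h : Env G H s σ)
    {k : ℕ} (hk : 2 ≤ k) (h' : Same k σ τ) : Env G H s τ := by
  refine ⟨?_, ?_, ?_, ?_, ?_⟩
  · rw [h'.reg 0 (by omega) (by omega)]; exact h.reg0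
  · rw [h'.reg 1 (by omega) (by omega)]; exact h.reg1
  · rw [h'.arr 0 (by omega)]; exact h.arr0
  · rw [h'.arr 1 (by omega)]; exact h.arr1
  · rw [h'.arr 2 (by omega)]; exact h.arr2

/-- The graph without the failing edges. -/
abbrev minus (G : SimpleGraph (Fin n)) (a b c d : Fin n) : SimpleGraph (Fin n) :=
  G.deleteEdges {s(a, b), s(c, d)}

/-- The registers `7` and `8` hold the failing edges. -/
def Faults (a b c d : Fin n) (σ : State) : Prop :=
  σ.reg 7 = (a : ℕ) * n + b ∧ σ.reg 8 = (c : ℕ) * n + d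

theorem eval_cell {G H : SimpleGraph (Fin n)} {s : Fin n} {σ : State} (h : Env G H s σ) {x y : ℕ}
    (hx : σ.reg x ≤ n) : (cell x y).eval σ = σ.reg x * n + σ.reg y := by
  simp only [cell, Exp.eval, h.arr2 _ hx]

theorem eval_survives {G H : SimpleGraph (Fin n)} {s a b c d : Fin n} {σ : State} (h : Env G H s σ)
    (hF : Faults a b c d σ) {u v : Fin n} (hu : σ.reg 11 = u) (hv : σ.reg 10 = v) :
    survives.eval σ = bit (s(u, v) ≠ s(a, b) ∧ s(u, v) ≠ s(c, d)) := by
  have h1 : (cell 11 10).eval σ = (u : ℕ) * n + v := by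
    rw [eval_cell h (by rw [hu]; exact u.2.le), hu, hv]
  have h2 : (cell 10 11).eval σ = (v : ℕ) * n + u := by
    rw [eval_cell h (by rw [hv]; exact v.2.le), hu, hv]
  have key : ∀ (P Q P' Q' : Prop) [Decidable P] [Decidable Q] [Decidable P'] [Decidable Q'],
      (if (if P then 1 else 0) + (if Q then 1 else 0) +
        ((if P' then 1 else 0) + (if Q' then 1 else 0)) = 0 then 1 else 0) =
      bit (¬ (P ∨ Q) ∧ ¬ (P' ∨ Q')) := by
    intro P Q P' Q' _ _ _ _
    by_cases h1 : P <;> by_cases h2 : Q <;> by_cases h3 : P' <;> by_cases h4 : Q' <;>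
      simp [bit, h1, h2, h3, h4]
  simp only [survives, Exp.eval, h1, h2, hF.1, hF.2, code_inj, ne_eq, Sym2.eq_iff]
  rw [and_comm (a := u = b), and_comm (a := u = d)]
  exact key _ _ _ _

end RAM

/-! ### correctness of the fault-tolerance test -/

namespace RAM

variable {n : ℕ} {G H : SimpleGraph (Fin n)} {s a b c d : Fin n} {σ : State}

theorem exists_lt_succ {i : ℕ} (hi : i < n) {P : Fin n → Prop} :
    (∃ u : Fin n, (u : ℕ) < i + 1 ∧ P u) ↔ (∃ u : Fin n, (u : ℕ) < i ∧ P u) ∨ P ⟨i, hi⟩ := by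
  constructor
  · rintro ⟨u, hu, h⟩
    rcases Nat.lt_succ_iff_lt_or_eq.1 hu with hu | rfl
    · exact .inl ⟨u, hu, h⟩
    · exact .inr h
  · rintro (⟨u, hu, h⟩ | h)
    · exact ⟨u, by omega, h⟩
    · exact ⟨⟨i, hi⟩, Nat.lt_succ_self i, h⟩

theorem forall_lt_succ {i : ℕ} (hi : i < n) {P : Fin n → Prop} :
    (∀ u : Fin n, (u : ℕ) < i + 1 → P u) ↔ (∀ u : Fin n, (u : ℕ) < i → P u) ∧ P ⟨i, hi⟩ := by
  constructor
  · exact fun h => ⟨fun u hu => h u (by omega), h _ (Nat.lt_succ_self i)⟩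
  · rintro ⟨h1, h2⟩ u hu
    rcases Nat.lt_succ_iff_lt_or_eq.1 hu with hu | rfl
    · exact h1 u hu
    · exact h2

theorem runs_scan (hE : Env G H s σ) (hF : Faults a b c d σ) {j : ℕ} (hj : j < n)
    (h9 : σ.reg 9 = j) {v : Fin n} (h10 : σ.reg 10 = v) {R : Fin n → Prop}
    (hR : ∀ u : Fin n, σ.arr 3 (j * n + u) = bit (R u)) (h12 : σ.reg 12 = bit (R v))
    (h13 : σ.reg 13 = bit (R v)) :
    Runs (forUp 11 (.var 0) scanBody) σ (loopTime n 60) fun τ =>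
      τ.arr = σ.arr ∧ (∀ x < 11, τ.reg x = σ.reg x) ∧
      τ.reg 12 = bit (ballStep (minus G a b c d) R v) ∧
      τ.reg 13 = bit (ballStep (minus H a b c d) R v) := by
  let A : SimpleGraph (Fin n) → ℕ → Prop := fun K i =>
    R v ∨ ∃ u : Fin n, (u : ℕ) < i ∧ (R u ∧ (minus K a b c d).Adj u v)
  have hA : ∀ K i (hi : i < n), A K (i + 1) ↔
      A K i ∨ (R ⟨i, hi⟩ ∧ (minus K a b c d).Adj ⟨i, hi⟩ v) := by
    intro K i hi
    simp only [A]
    rw [exists_lt_succ hi, or_assoc]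
  refine (Runs.forUp (fun i τ => τ.arr = σ.arr ∧ (∀ x < 11, τ.reg x = σ.reg x) ∧ τ.reg 11 = i ∧
    τ.reg 12 = bit (A G i) ∧ τ.reg 13 = bit (A H i)) (N := n) (T := 60) (by simp [Exp.cost])
    ?_ ?_ ?_).mono le_rfl ?_
  · refine ⟨rfl, fun x hx => Function.update_of_ne (by omega) _ _, by simp [State.setReg], ?_, ?_⟩
    · simp [State.setReg, h12, A]
    · simp [State.setReg, h13, A]
  · rintro i - τ ⟨-, h1, h2, -⟩
    exact ⟨h2, by simp only [Exp.eval]; rw [h1 0 (by omega), hE.reg0]⟩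
  · rintro i hi τ ⟨h1, h2, h3, h4, h5⟩
    have hτ : Env G H s τ := by
      refine hE.of_same (k := 11) (by omega) ⟨fun x hx _ => h2 x hx, fun a _ => by rw [h1]⟩
    have hτF : Faults a b c d τ := by
      refine ⟨?_, ?_⟩
      · rw [h2 7 (by omega)]; exact hF.1
      · rw [h2 8 (by omega)]; exact hF.2
    have h9' : τ.reg 9 = j := by rw [h2 9 (by omega), h9]
    have h10' : τ.reg 10 = v := by rw [h2 10 (by omega), h10]
    set u : Fin n := ⟨i, hi⟩ with hu
    -- It suffices to update the two answers.
    have post : ∀ τ' : State, τ'.arr = τ.arr → (∀ x < 12, τ'.reg x = τ.reg x) →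
        τ'.reg 12 = bit (A G i ∨ (R u ∧ (minus G a b c d).Adj u v)) →
        τ'.reg 13 = bit (A H i ∨ (R u ∧ (minus H a b c d).Adj u v)) →
        τ'.reg 11 = i ∧ (τ'.setReg 11 (i + 1)).arr = σ.arr ∧
          (∀ x < 11, (τ'.setReg 11 (i + 1)).reg x = σ.reg x) ∧
          (τ'.setReg 11 (i + 1)).reg 11 = i + 1 ∧
          (τ'.setReg 11 (i + 1)).reg 12 = bit (A G (i + 1)) ∧
          (τ'.setReg 11 (i + 1)).reg 13 = bit (A H (i + 1)) := by
      intro τ' e1 e2 e3 e4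
      refine ⟨by rw [e2 11 (by omega), h3], e1.trans h1, fun x hx => ?_, by simp [State.setReg],
        ?_, ?_⟩
      · simp only [State.setReg]
        rw [Function.update_of_ne (by omega), e2 x (by omega), h2 x hx]
      · rw [hA G i hi, ← e3]
        simp [State.setReg]
      · rw [hA H i hi, ← e4]
        simp [State.setReg]
    have hcell : ∀ x y, x = 11 ∧ y = 10 → (cell x y).eval τ = (u : ℕ) * n + v := by
      rintro x y ⟨rfl, rfl⟩
      rw [eval_cell hτ (by rw [h3]; exact hi.le), h3, h10']
    have hadj : ∀ K : SimpleGraph (Fin n), (minus K a b c d).Adj u v ↔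
        K.Adj u v ∧ (s(u, v) ≠ s(a, b) ∧ s(u, v) ≠ s(c, d)) := by
      intro K
      simp [minus, SimpleGraph.deleteEdges_adj]
    refine Runs.ite 46 (by simp [Exp.cost, cell]) (fun hRu => ?_) (fun hRu => ?_)
    · refine Runs.ite 16 (by simp [Exp.cost, cell, survives]) (fun hs => ?_) (fun hs => ?_)
      · rw [eval_survives hτ hτF (u := u) h3 h10', bit_ne_zero] at hs
        have hRu' : R u := by
          rw [Exp.eval, eval_cell hτ (by rw [h9']; exact hj.le), h9', h3, h1] at hRu
          refine bit_ne_zero.1 ?_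
          rw [← hR u]
          exact hRu
        refine Runs.seq 8 8 le_rfl ?_
        have key : Runs (.ite (.get 0 (cell 11 10)) (.set 12 (.lit 1)) .skip) τ 8 fun τ' =>
            τ'.arr = τ.arr ∧ (∀ x < 12, τ'.reg x = τ.reg x) ∧
            τ'.reg 12 = bit (A G i ∨ (R u ∧ (minus G a b c d).Adj u v)) ∧
            τ'.reg 13 = τ.reg 13 := by
          have hc : (Exp.get 0 (cell 11 10)).eval τ = bit (G.Adj u v) := by
            rw [Exp.eval, hcell _ _ ⟨rfl, rfl⟩, hτ.arr0]
          refine Runs.ite 2 (by simp [Exp.cost, cell])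
            (fun hg => Runs.set (by simp [Exp.cost]) ?_) (fun hg => Runs.skip (by omega) ?_)
          · rw [hc, bit_ne_zero] at hg
            refine ⟨rfl, fun x hx => Function.update_of_ne (by omega) _ _, ?_, ?_⟩
            · rw [bit_true (.inr ⟨hRu', (hadj G).2 ⟨hg, hs⟩⟩)]
              simp [State.setReg, Exp.eval]
            · simp [State.setReg]
          · rw [hc, bit_eq_zero] at hg
            refine ⟨rfl, fun _ _ => rfl, ?_, rfl⟩
            rw [h4, bit_inj, or_iff_left]
            exact fun h => hg ((hadj G).1 h.2).1
        refine key.mono le_rfl ?_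
        rintro τ' ⟨e1, e2, e3, e4⟩
        have hc : (Exp.get 1 (cell 11 10)).eval τ' = bit (H.Adj u v) := by
          rw [Exp.eval, cell, Exp.eval, Exp.eval, Exp.eval, Exp.eval, e1, e2 11 (by omega),
            e2 10 (by omega), ← hτ.arr1 u v, ← hcell 11 10 ⟨rfl, rfl⟩]
          rfl
        refine Runs.ite 2 (by simp [Exp.cost, cell])
            (fun hg => Runs.set (by simp [Exp.cost]) ?_) (fun hg => Runs.skip (by omega) ?_)
        · rw [hc, bit_ne_zero] at hg
          refine post _ e1 (fun x hx => ?_) ?_ ?_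
          · simp only [State.setReg]
            rw [Function.update_of_ne (by omega), e2 x hx]
          · rw [← e3]
            simp [State.setReg]
          · rw [bit_true (.inr ⟨hRu', (hadj H).2 ⟨hg, hs⟩⟩)]
            simp [State.setReg, Exp.eval]
        · rw [hc, bit_eq_zero] at hg
          refine post _ e1 e2 e3 ?_
          rw [e4, h5, bit_inj, or_iff_left]
          exact fun h => hg ((hadj H).1 h.2).1
      · rw [eval_survives hτ hτF (u := u) h3 h10', bit_eq_zero] at hs
        refine Runs.skip (by omega) ?_
        refine post _ rfl (fun _ _ => rfl) ?_ ?_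
        · rw [h4, bit_inj, or_iff_left]
          exact fun h => hs ((hadj G).1 h.2).2
        · rw [h5, bit_inj, or_iff_left]
          exact fun h => hs ((hadj H).1 h.2).2
    · have hRu' : ¬ R u := by
        rw [Exp.eval, eval_cell hτ (by rw [h9']; exact hj.le), h9', h3, h1] at hRu
        refine bit_eq_zero.1 ?_
        rw [← hR u]
        exact hRu
      refine Runs.skip (by omega) ?_
      refine post _ rfl (fun _ _ => rfl) ?_ ?_
      · rw [h4, bit_inj, or_iff_left]
        exact fun h => hRu' h.1
      · rw [h5, bit_inj, or_iff_left]
        exact fun h => hRu' h.1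
  · rintro τ ⟨h1, h2, -, h4, h5⟩
    have hAn : ∀ K, A K n ↔ ballStep (minus K a b c d) R v := by
      intro K
      simp [A, ballStep]
    exact ⟨h1, h2, by rw [h4, hAn], by rw [h5, hAn]⟩

end RAM

namespace RAM

variable {n : ℕ} {G H : SimpleGraph (Fin n)} {s a b c d : Fin n} {σ : State}

theorem Faults.of_same {τ : State} (h : Faults a b c d σ) {k : ℕ} (hk : 9 ≤ k)
    (h' : Same k σ τ) : Faults a b c d τ :=
  ⟨(h'.reg 7 (by omega) (by omega)).trans h.1, (h'.reg 8 (by omega) (by omega)).trans h.2⟩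

theorem runs_extend (hE : Env G H s σ) (hF : Faults a b c d σ) {j : ℕ} (hj : j < n)
    (h9 : σ.reg 9 = j) {R : Fin n → Prop} (hR : ∀ u : Fin n, σ.arr 3 (j * n + u) = bit (R u))
    {P : Prop} (h6 : σ.reg 6 = bit P) :
    Runs (forUp 10 (.var 0) extendBody) σ (loopTime n (extendTime n)) fun τ =>
      Same 10 σ τ ∧
      (∀ u : Fin n, τ.arr 3 ((j + 1) * n + u) = bit (ballStep (minus G a b c d) R u)) ∧
      τ.reg 6 = bit (P ∧
        ∀ v, ballStep (minus G a b c d) R v ↔ ballStep (minus H a b c d) R v) := by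
  let g := ballStep (minus G a b c d) R
  let h := ballStep (minus H a b c d) R
  refine (Runs.forUp (fun i τ => Same 10 σ τ ∧ τ.reg 10 = i ∧
    (∀ u : Fin n, τ.arr 3 (j * n + u) = bit (R u)) ∧
    (∀ u : Fin n, (u : ℕ) < i → τ.arr 3 ((j + 1) * n + u) = bit (g u)) ∧
    τ.reg 6 = bit (P ∧ ∀ v : Fin n, (v : ℕ) < i → (g v ↔ h v))) (N := n) (T := extendTime n)
    (by simp [Exp.cost]) ?_ ?_ ?_).mono le_rfl ?_
  · refine ⟨(Same.refl 10 σ).setReg (by omega) 0, by simp [State.setReg], hR, by simp, ?_⟩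
    simp [State.setReg, h6]
  · rintro i - τ ⟨h1, h2, -⟩
    exact ⟨h2, (h1.reg 0 (by omega) (by omega)).trans hE.reg0⟩
  · rintro i hi τ ⟨h1, h2, h3, h4, h5⟩
    have hτ : Env G H s τ := hE.of_same (by omega) h1
    have hτF : Faults a b c d τ := hF.of_same (by omega) h1
    have h9' : τ.reg 9 = j := (h1.reg 9 (by omega) (by omega)).trans h9
    set v : Fin n := ⟨i, hi⟩ with hv
    have e12 : (Exp.get 3 (cell 9 10)).eval τ = bit (R v) := by
      rw [Exp.eval, eval_cell hτ (by rw [h9']; exact hj.le), h9', h2]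
      exact h3 v
    refine Runs.seq 6 (loopTime n 60 + 34) (by simp only [extendTime]; omega)
      (Runs.set (by simp [Exp.cost, cell]) ?_)
    rw [e12]
    refine Runs.seq 2 (loopTime n 60 + 32) (by omega) (Runs.set (by simp [Exp.cost]) ?_)
    set τ₁ := (τ.setReg 12 (bit (R v))).setReg 13
      ((Exp.var 12).eval (τ.setReg 12 (bit (R v)))) with hτ₁
    have s₁ : Same 10 τ τ₁ := ((Same.refl 10 τ).setReg (by omega) _).setReg (by omega) _
    refine Runs.seq (loopTime n 60) 32 (by omega) ?_
    refine (runs_scan (hτ.of_same (by omega) s₁) (hτF.of_same (by omega) s₁) hj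
      ((s₁.reg 9 (by omega) (by omega)).trans h9') (v := v) (by simp [hτ₁, State.setReg, h2, hv])
      (R := R) h3 (by simp [hτ₁, State.setReg]) (by simp [hτ₁, State.setReg, Exp.eval])).mono
      le_rfl ?_
    rintro ρ ⟨r1, r2, r3, r4⟩
    have hρ0 : ∀ x < 11, ρ.reg x = τ.reg x := by
      intro x hx
      rw [r2 x hx]
      simp only [hτ₁, State.setReg]
      rw [Function.update_of_ne (by omega), Function.update_of_ne (by omega)]
    have hρarr : ρ.arr = τ.arr := r1
    have hidx : (Exp.add (.get 2 (.add (.var 9) (.lit 1))) (.var 10)).eval ρ =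
        (j + 1) * n + (v : ℕ) := by
      simp only [Exp.eval]
      rw [hρ0 9 (by omega), hρ0 10 (by omega), h9', h2, hρarr, hτ.arr2 _ hj]
    refine Runs.seq 8 20 (by omega) (Runs.put (by simp [Exp.cost]) ?_)
    rw [hidx, show (Exp.var 12).eval ρ = bit (g v) from r3]
    set ρ' := ρ.setArr 3 ((j + 1) * n + (v : ℕ)) (bit (g v)) with hρ'
    have hcell : ρ'.arr 3 = Function.update (ρ.arr 3) ((j + 1) * n + (v : ℕ)) (bit (g v)) := by
      simp [hρ', State.setArr]
    have hreg : ρ'.reg = ρ.reg := rfl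
    have sρ : Same 10 σ ρ' := by
      refine h1.trans ?_
      have : Same 10 τ ρ := ⟨fun x hx _ => hρ0 x (by omega), fun a _ => by rw [hρarr]⟩
      exact this.setArr _ _
    have row : ∀ u : Fin n, ρ'.arr 3 (j * n + u) = bit (R u) := by
      intro u
      rw [hcell, Function.update_of_ne, hρarr, h3 u]
      have := u.2
      rw [Nat.succ_mul]
      omega
    have row' : ∀ u : Fin n, (u : ℕ) < i + 1 → ρ'.arr 3 ((j + 1) * n + u) = bit (g u) := by
      rw [forall_lt_succ hi]
      refine ⟨fun u hu => ?_, by rw [hcell, Function.update_self]⟩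
      have : (v : ℕ) = i := rfl
      rw [hcell, Function.update_of_ne (by omega), hρarr, h4 u hu]
    have heq : (Exp.eq (.var 12) (.var 13)).eval ρ' ≠ 0 ↔ (g v ↔ h v) := by
      have : (Exp.eq (.var 12) (.var 13)).eval ρ' = if bit (g v) = bit (h v) then 1 else 0 := by
        rw [← r3, ← r4]
        rfl
      rw [this]
      refine Iff.trans ?_ bit_inj
      simp
    refine Runs.ite 2 (by simp [Exp.cost]) (fun hc => Runs.skip (by omega) ?_)
      (fun hc => Runs.set (by simp [Exp.cost]) ?_)
    · rw [heq] at hc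
      refine ⟨by rw [hreg, hρ0 10 (by omega), h2], sρ.setReg (by omega) _, by simp [State.setReg],
        row, row', ?_⟩
      have : (ρ'.setReg 10 (i + 1)).reg 6 = τ.reg 6 := by
        rw [← hρ0 6 (by omega), ← hreg]
        simp [State.setReg]
      rw [this, h5, bit_inj, forall_lt_succ hi]
      exact and_congr_right fun _ => (and_iff_left hc).symm
    · have hc' : ¬ (g v ↔ h v) := fun hh => heq.2 hh hc
      refine ⟨?_, (sρ.setReg (by omega) _).setReg (by omega) _, by simp [State.setReg],
        row, row', ?_⟩
      · rw [← h2, ← hρ0 10 (by omega), ← hreg]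
        simp [State.setReg]
      · rw [bit_false]
        · simp [State.setReg, Exp.eval]
        · rw [forall_lt_succ hi]
          exact fun hh => hc' hh.2.2
  · rintro τ ⟨h1, -, -, h4, h5⟩
    refine ⟨h1, fun u => h4 u u.2, ?_⟩
    rw [h5, bit_inj]
    simp [g, h]

theorem runs_compare (hE : Env G H s σ) (hF : Faults a b c d σ) {P : Prop} (h6 : σ.reg 6 = bit P) :
    Runs compareProg σ (compareTime n) fun τ => Same 9 σ τ ∧
      τ.reg 6 = bit (P ∧ ∀ v, (minus H a b c d).edist s v = (minus G a b c d).edist s v) := by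
  refine Runs.seq (loopTime n 20) (loopTime n (loopTime n (extendTime n))) le_rfl ?_
  refine (Runs.forUp (fun i τ => Same 10 σ τ ∧ τ.reg 6 = σ.reg 6 ∧ τ.reg 10 = i ∧
    ∀ u : Fin n, (u : ℕ) < i → τ.arr 3 u = bit (u = s)) (N := n) (T := 20) (by simp [Exp.cost])
    ?_ ?_ ?_).mono le_rfl ?_
  · exact ⟨(Same.refl 10 σ).setReg (by omega) 0, by simp [State.setReg], by simp [State.setReg],
      by simp⟩
  · rintro i - τ ⟨h1, -, h2, -⟩
    exact ⟨h2, (h1.reg 0 (by omega) (by omega)).trans hE.reg0⟩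
  · rintro i hi τ ⟨h1, h2, h3, h4⟩
    refine Runs.put (by simp [Exp.cost]) ?_
    have hτ : Env G H s τ := hE.of_same (by omega) h1
    have e : (Exp.eq (.var 10) (.var 1)).eval τ = bit ((⟨i, hi⟩ : Fin n) = s) := by
      simp only [Exp.eval, h3, hτ.reg1, bit, Fin.ext_iff]
    rw [e, show (Exp.var 10).eval τ = i from h3]
    refine ⟨h3, (h1.setArr _ _).setReg (by omega) _, ?_, by simp [State.setReg], ?_⟩
    · rw [← h2]
      simp [State.setReg, State.setArr]
    · rw [forall_lt_succ hi]
      refine ⟨fun u hu => ?_, by simp [State.setReg, State.setArr]⟩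
      rw [← h4 u hu]
      simp only [State.setReg, State.setArr, Function.update_self]
      exact Function.update_of_ne (by omega) _ _
  · rintro τ ⟨h1, h2, -, h4⟩
    have hτ : Env G H s τ := hE.of_same (by omega) h1
    have hτF : Faults a b c d τ := hF.of_same (by omega) h1
    refine (Runs.forUp (fun j ρ => Same 9 σ ρ ∧ ρ.reg 9 = j ∧
      (∀ u : Fin n, ρ.arr 3 (j * n + u) = bit (ball (minus G a b c d) s j u)) ∧
      ρ.reg 6 = bit (P ∧ ∀ j' < j, ∀ v, ballStep (minus G a b c d)
        (ball (minus G a b c d) s j') v ↔ ballStep (minus H a b c d)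
        (ball (minus G a b c d) s j') v)) (N := n) (T := loopTime n (extendTime n))
        (by simp [Exp.cost]) ?_ ?_ ?_).mono le_rfl ?_
    · refine ⟨(h1.mono (by omega)).setReg (by omega) 0, by simp [State.setReg], fun u => ?_, ?_⟩
      · rw [Nat.zero_mul, Nat.zero_add]
        exact h4 u u.2
      · simp only [not_lt_zero, false_imp_iff, implies_true, and_true, ← h6, ← h2]
        simp [State.setReg]
    · rintro i - ρ ⟨h1, h2, -⟩
      exact ⟨h2, (h1.reg 0 (by omega) (by omega)).trans hE.reg0⟩
    · rintro j hj ρ ⟨e1, e2, e3, e4⟩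
      refine (runs_extend (hE.of_same (by omega) e1) (hF.of_same (by omega) e1) hj e2 e3 e4).mono
        le_rfl ?_
      rintro ρ' ⟨f1, f2, f3⟩
      refine ⟨(f1.reg 9 (by omega) (by omega)).trans e2,
        (e1.trans (f1.mono (by omega))).setReg (by omega) _, by simp [State.setReg], f2, ?_⟩
      have : (ρ'.setReg 9 (j + 1)).reg 6 = ρ'.reg 6 := by simp [State.setReg]
      rw [this, f3, bit_inj, and_assoc]
      refine and_congr_right fun _ => ⟨?_, fun h => ⟨fun j' hj' => h j' (by omega), h j (by omega)⟩⟩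
      rintro ⟨g1, g2⟩ j' hj'
      rcases Nat.lt_succ_iff_lt_or_eq.1 hj' with hj' | rfl
      · exact g1 j' hj'
      · exact g2
    · rintro ρ ⟨e1, -, -, e4⟩
      refine ⟨e1, ?_⟩
      rw [e4, bit_inj, forall_ballStep_iff (by simp)]

theorem eval_square (hE : Env G H s σ) : (Exp.get 2 (.var 0)).eval σ = n * n := by
  simp only [Exp.eval, hE.reg0, hE.arr2 n le_rfl]

theorem runs_test (hE : Env G H s σ) (hHG : H ≤ G) :
    Runs testProg σ (testTime n) fun τ => Same 7 σ τ ∧ τ.reg 6 = bit (IsFTBFS 2 G s H) := by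
  let D : Fin n → Fin n → Fin n → Fin n → Prop := fun a b c d =>
    ∀ v, (minus H a b c d).edist s v = (minus G a b c d).edist s v
  refine Runs.seq 5 (loopTime (n * n) (loopTime (n * n) (compareTime n))) le_rfl
    (Runs.set (by simp [Exp.cost]) ?_)
  have s₀ : Same 7 σ (σ.setReg 6 ((Exp.lit 1).eval σ)) := (Same.refl 7 σ).setReg (by omega) _
  refine (Runs.forUp (fun i τ => Same 7 σ τ ∧ τ.reg 7 = i ∧
    τ.reg 6 = bit (∀ a b : Fin n, (a : ℕ) * n + b < i → ∀ c d, D a b c d)) (N := n * n)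
    (T := loopTime (n * n) (compareTime n)) (by simp [Exp.cost]) ?_ ?_ ?_).mono le_rfl ?_
  · refine ⟨s₀.setReg (by omega) 0, by simp [State.setReg], ?_⟩
    rw [bit_true (by simp)]
    simp [State.setReg, Exp.eval]
  · rintro i - τ ⟨h1, h2, -⟩
    exact ⟨h2, eval_square (hE.of_same (by omega) h1)⟩
  · rintro i hi τ ⟨h1, h2, h3⟩
    obtain ⟨a, b, hab⟩ := exists_code hi
    set P := ∀ a b : Fin n, (a : ℕ) * n + b < i → ∀ c d, D a b c d with hP
    refine (Runs.forUp (fun i' ρ => Same 8 τ ρ ∧ ρ.reg 8 = i' ∧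
      ρ.reg 6 = bit (P ∧ ∀ c d : Fin n, (c : ℕ) * n + d < i' → D a b c d)) (N := n * n)
      (T := compareTime n) (by simp [Exp.cost]) ?_ ?_ ?_).mono le_rfl ?_
    · refine ⟨(Same.refl 8 τ).setReg (by omega) 0, by simp [State.setReg], ?_⟩
      simp only [not_lt_zero, false_imp_iff, implies_true, and_true, ← h3]
      simp [State.setReg]
    · rintro i' - ρ ⟨e1, e2, -⟩
      exact ⟨e2, eval_square (hE.of_same (by omega) (h1.trans (e1.mono (by omega))))⟩
    · rintro i' hi' ρ ⟨e1, e2, e3⟩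
      obtain ⟨c, d, hcd⟩ := exists_code hi'
      refine (runs_compare (a := a) (b := b) (c := c) (d := d)
        (hE.of_same (by omega) (h1.trans (e1.mono (by omega))))
        ⟨((e1.reg 7 (by omega) (by omega)).trans h2).trans hab, e2.trans hcd⟩ e3).mono le_rfl ?_
      rintro ρ' ⟨f1, f2⟩
      refine ⟨(f1.reg 8 (by omega) (by omega)).trans e2,
        (e1.trans (f1.mono (by omega))).setReg (by omega) _, by simp [State.setReg], ?_⟩
      have : (ρ'.setReg 8 (i' + 1)).reg 6 = ρ'.reg 6 := by simp [State.setReg]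
      rw [this, f2, bit_inj, and_assoc]
      refine and_congr_right fun _ => ⟨?_, fun h => ⟨fun c d hj' => h c d (by omega),
        h c d (by omega)⟩⟩
      rintro ⟨g1, g2⟩ c' d' hj'
      rcases Nat.lt_succ_iff_lt_or_eq.1 hj' with hj' | hj'
      · exact g1 c' d' hj'
      · obtain ⟨rfl, rfl⟩ := code_inj.1 (hj'.trans hcd)
        exact g2
    · rintro ρ ⟨e1, -, e3⟩
      refine ⟨(e1.reg 7 (by omega) (by omega)).trans h2,
        (h1.trans (e1.mono (by omega))).setReg (by omega) _, by simp [State.setReg], ?_⟩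
      have : (ρ.setReg 7 (i + 1)).reg 6 = ρ.reg 6 := by simp [State.setReg]
      rw [this, e3, bit_inj]
      constructor
      · rintro ⟨g1, g2⟩ a' b' hj' c d
        rcases Nat.lt_succ_iff_lt_or_eq.1 hj' with hj' | hj'
        · exact g1 a' b' hj' c d
        · obtain ⟨rfl, rfl⟩ := code_inj.1 (hj'.trans hab)
          exact g2 c d (code_lt c d)
      · exact fun h => ⟨fun a b hj' => h a b (by omega), fun c d _ => h a b (by omega) c d⟩
  · rintro τ ⟨h1, -, h3⟩
    refine ⟨h1, ?_⟩
    rw [h3, bit_inj, isFTBFS_two_iff hHG]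
    exact ⟨fun h a b c d => h a b (code_lt a b) c d, fun h a b _ c d => h a b c d⟩

end RAM

/-! ### correctness of the greedy program -/

namespace RAM

variable {n : ℕ} {G H : SimpleGraph (Fin n)} {s : Fin n} {σ : State}

open Classical in
/-- Delete the edge between `x` and `y` if the graph stays fault-tolerant. -/
noncomputable def greedyStep (G : SimpleGraph (Fin n)) (s : Fin n) (H : SimpleGraph (Fin n))
    (x y : Fin n) : SimpleGraph (Fin n) :=
  if IsFTBFS 2 G s (H.deleteEdges {s(x, y)}) then H.deleteEdges {s(x, y)} else H

/-- Writing the same number at `(x, y)` and `(y, x)`. -/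
theorem update_code {f : ℕ → ℕ} {x y : Fin n} {k : ℕ} (u v : Fin n) :
    Function.update (Function.update f ((x : ℕ) * n + y) k) ((y : ℕ) * n + x) k
      ((u : ℕ) * n + v) = if s(u, v) = s(x, y) then k else f ((u : ℕ) * n + v) := by
  simp only [Function.update_apply, code_inj, Sym2.eq_iff]
  by_cases h1 : u = y ∧ v = x
  · rw [if_pos h1, if_pos (.inr h1)]
  · by_cases h2 : u = x ∧ v = y
    · rw [if_neg h1, if_pos h2, if_pos (.inl h2)]
    · rw [if_neg h1, if_neg h2, if_neg (by tauto)]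

theorem runs_reduce (hE : Env G H s σ) (hHG : H ≤ G) {x y : Fin n} (h3 : σ.reg 3 = x)
    (h4 : σ.reg 4 = y) :
    Runs reduceBody σ (testTime n + 60) fun τ =>
      (∀ z < 5, τ.reg z = σ.reg z) ∧ Env G (greedyStep G s H x y) s τ := by
  classical
  have c34 : (cell 3 4).eval σ = (x : ℕ) * n + y := by
    rw [eval_cell hE (by rw [h3]; exact x.2.le), h3, h4]
  have c43 : (cell 4 3).eval σ = (y : ℕ) * n + x := by
    rw [eval_cell hE (by rw [h4]; exact y.2.le), h3, h4]
  have hcell : ∀ (x y : ℕ) (τ : State), τ.reg x = σ.reg x → τ.reg y = σ.reg y →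
      τ.arr 2 = σ.arr 2 → (cell x y).eval τ = (cell x y).eval σ := by
    intro x y τ e1 e2 e3
    simp only [cell, Exp.eval, e1, e2, e3]
  refine Runs.seq 6 (testTime n + 54) (by omega) (Runs.set (by simp [Exp.cost, cell]) ?_)
  have e5 : (Exp.get 1 (cell 3 4)).eval σ = bit (H.Adj x y) := by
    rw [Exp.eval, c34, hE.arr1]
  rw [e5]
  set σ₁ := σ.setReg 5 (bit (H.Adj x y)) with hσ₁
  have r₁ : ∀ z < 5, σ₁.reg z = σ.reg z := fun z hz => Function.update_of_ne (by omega) _ _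
  refine Runs.seq 6 (testTime n + 48) (by omega) (Runs.put (by simp [Exp.cost, cell]) ?_)
  rw [hcell 3 4 σ₁ (r₁ 3 (by omega)) (r₁ 4 (by omega)) rfl, c34]
  set σ₂ := σ₁.setArr 1 ((x : ℕ) * n + y) ((Exp.lit 0).eval σ₁) with hσ₂
  have a₂ : σ₂.arr 2 = σ.arr 2 := rfl
  refine Runs.seq 6 (testTime n + 42) (by omega) (Runs.put (by simp [Exp.cost, cell]) ?_)
  rw [hcell 4 3 σ₂ (r₁ 4 (by omega)) (r₁ 3 (by omega)) a₂, c43]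
  set σ₃ := σ₂.setArr 1 ((y : ℕ) * n + x) ((Exp.lit 0).eval σ₂) with hσ₃
  have E₃ : Env G (H.deleteEdges {s(x, y)}) s σ₃ := by
    refine ⟨(r₁ 0 (by omega)).trans hE.reg0, (r₁ 1 (by omega)).trans hE.reg1, hE.arr0, ?_, hE.arr2⟩
    intro u v
    have : σ₃.arr 1 = Function.update (Function.update (σ.arr 1) ((x : ℕ) * n + y) 0)
        ((y : ℕ) * n + x) 0 := by
      simp [hσ₃, hσ₂, hσ₁, State.setArr, State.setReg, Exp.eval]
    rw [this, update_code, hE.arr1, SimpleGraph.deleteEdges_adj, Set.mem_singleton_iff]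
    by_cases h : s(u, v) = s(x, y)
    · rw [if_pos h, bit_false fun h' => h'.2 h]
    · rw [if_neg h, bit_inj, and_iff_left h]
  refine Runs.seq (testTime n) 42 (by omega) ?_
  refine (runs_test E₃ ((SimpleGraph.deleteEdges_le _).trans hHG)).mono le_rfl ?_
  rintro τ ⟨S, hflag⟩
  have rτ : ∀ z < 5, τ.reg z = σ.reg z := fun z hz =>
    (S.reg z (by omega) (by omega)).trans (r₁ z hz)
  have Eτ := E₃.of_same (by omega) S
  refine Runs.ite 20 (by simp [Exp.cost]) (fun hc => Runs.skip (by omega) ?_) (fun hc => ?_)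
  · rw [Exp.eval, hflag, bit_ne_zero] at hc
    refine ⟨rτ, ?_⟩
    rwa [greedyStep, if_pos hc]
  · rw [Exp.eval, hflag, bit_eq_zero] at hc
    have t5 : τ.reg 5 = bit (H.Adj x y) := by
      rw [S.reg 5 (by omega) (by omega)]
      simp [hσ₃, hσ₂, hσ₁, State.setArr, State.setReg]
    have aτ : τ.arr 2 = σ.arr 2 := S.arr 2 (by omega)
    refine Runs.seq 6 6 (by omega) (Runs.put (by simp [Exp.cost, cell]) ?_)
    rw [hcell 3 4 τ (rτ 3 (by omega)) (rτ 4 (by omega)) aτ, c34]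
    set τ₁ := τ.setArr 1 ((x : ℕ) * n + y) ((Exp.var 5).eval τ) with hτ₁
    refine Runs.put (by simp [Exp.cost, cell]) ?_
    rw [hcell 4 3 τ₁ (rτ 4 (by omega)) (rτ 3 (by omega)) aτ, c43]
    set τ₂ := τ₁.setArr 1 ((y : ℕ) * n + x) ((Exp.var 5).eval τ₁) with hτ₂
    refine ⟨rτ, ?_⟩
    rw [greedyStep, if_neg hc]
    refine ⟨Eτ.reg0, Eτ.reg1, Eτ.arr0, ?_, Eτ.arr2⟩
    intro u v
    have : τ₂.arr 1 = Function.update (Function.update (τ.arr 1) ((x : ℕ) * n + y)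
        (bit (H.Adj x y))) ((y : ℕ) * n + x) (bit (H.Adj x y)) := by
      simp [hτ₂, hτ₁, State.setArr, Exp.eval, t5]
    rw [this, update_code, Eτ.arr1, SimpleGraph.deleteEdges_adj, Set.mem_singleton_iff]
    by_cases h : s(u, v) = s(x, y)
    · rw [if_pos h, bit_inj, ← SimpleGraph.mem_edgeSet, ← h, SimpleGraph.mem_edgeSet]
    · rw [if_neg h, bit_inj, and_iff_left h]

/-- `H` is fault-tolerant, and no edge between vertices `u` and `v` with `D u v` can be deleted
from it. -/
def Reduced (G : SimpleGraph (Fin n)) (s : Fin n) (D : Fin n → Fin n → Prop)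
    (H : SimpleGraph (Fin n)) : Prop :=
  IsFTBFS 2 G s H ∧ ∀ u v, D u v → H.Adj u v → ¬ IsFTBFS 2 G s (H.deleteEdges {s(u, v)})

theorem Reduced.greedyStep {D : Fin n → Fin n → Prop} (h : Reduced G s D H) (x y : Fin n) :
    Reduced G s (fun u v => D u v ∨ (u = x ∧ v = y)) (greedyStep G s H x y) := by
  rw [RAM.greedyStep]
  split_ifs with hc
  · refine ⟨hc, fun u v hD hadj hF => ?_⟩
    rw [SimpleGraph.deleteEdges_adj] at hadj
    rcases hD with hD | ⟨rfl, rfl⟩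
    · exact h.2 u v hD hadj.1 (hF.of_le (SimpleGraph.deleteEdges_mono (SimpleGraph.deleteEdges_le _))
        ((SimpleGraph.deleteEdges_le _).trans h.1.1))
    · exact hadj.2 rfl
  · refine ⟨h.1, fun u v hD hadj => ?_⟩
    rcases hD with hD | ⟨rfl, rfl⟩
    · exact h.2 u v hD hadj
    · exact hc

theorem runs_greedy_loops (hE : Env G G s σ) :
    Runs (forUp 3 (.var 0) (forUp 4 (.var 0) reduceBody)) σ
      (loopTime n (loopTime n (testTime n + 60))) fun τ =>
        ∃ H, Env G H s τ ∧ Reduced G s (fun _ _ => True) H := by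
  have hset : ∀ {τ : State} {H : SimpleGraph (Fin n)}, Env G H s τ → ∀ x m, 2 ≤ x →
      Env G H s (τ.setReg x m) := fun h x m hx =>
    h.of_same (k := 2) le_rfl ((Same.refl 2 _).setReg (.inl hx) m)
  refine (Runs.forUp (fun i τ => τ.reg 3 = i ∧
    ∃ H, Env G H s τ ∧ Reduced G s (fun u _ => (u : ℕ) < i) H) (N := n)
    (T := loopTime n (testTime n + 60)) (by simp [Exp.cost]) ?_ ?_ ?_).mono le_rfl ?_
  · refine ⟨by simp [State.setReg], G, hset hE 3 0 (by omega), ⟨le_rfl, fun _ _ _ _ => rfl⟩, ?_⟩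
    intro u v h
    exact absurd h (Nat.not_lt_zero _)
  · rintro i - τ ⟨h1, H, h2, -⟩
    exact ⟨h1, h2.reg0⟩
  · rintro i hi τ ⟨h1, H, h2, h3⟩
    refine (Runs.forUp (fun k ρ => ρ.reg 3 = i ∧ ρ.reg 4 = k ∧ ∃ H, Env G H s ρ ∧
      Reduced G s (fun u v => (u : ℕ) < i ∨ ((u : ℕ) = i ∧ (v : ℕ) < k)) H) (N := n)
      (T := testTime n + 60) (by simp [Exp.cost]) ?_ ?_ ?_).mono le_rfl ?_
    · refine ⟨by simpa [State.setReg] using h1, by simp [State.setReg], H,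
        hset h2 4 0 (by omega), ?_⟩
      simpa using h3
    · rintro k - ρ ⟨-, e1, H, e2, -⟩
      exact ⟨e1, e2.reg0⟩
    · rintro k hk ρ ⟨e0, e1, H, e2, e3⟩
      refine (runs_reduce e2 e3.1.1 (x := ⟨i, hi⟩) (y := ⟨k, hk⟩) e0 e1).mono le_rfl ?_
      rintro ρ' ⟨f1, f2⟩
      refine ⟨(f1 4 (by omega)).trans e1, ?_, by simp [State.setReg], _,
        hset f2 4 _ (by omega), ?_⟩
      · simp only [State.setReg]
        rw [Function.update_of_ne (by omega), f1 3 (by omega), e0]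
      · have := e3.greedyStep ⟨i, hi⟩ ⟨k, hk⟩
        refine ⟨this.1, fun u v hD => this.2 u v ?_⟩
        simp only [Fin.ext_iff]
        omega
    · rintro ρ ⟨e0, -, H, e2, e3⟩
      refine ⟨e0, by simp [State.setReg], H, hset e2 3 _ (by omega), e3.1, fun u v hD =>
        e3.2 u v ?_⟩
      have := v.2
      omega
  · rintro τ ⟨-, H, h2, h3⟩
    exact ⟨H, h2, h3.1, fun u v _ => h3.2 u v u.2⟩

theorem runs_multiples (h0 : σ.reg 0 = n) (h14 : σ.reg 14 = 0) :
    Runs multiplesProg σ (loopTime (n + 1) 20) fun τ =>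
      τ.reg 0 = n ∧ τ.reg 1 = σ.reg 1 ∧ τ.arr 0 = σ.arr 0 ∧ ∀ i ≤ n, τ.arr 2 i = i * n := by
  refine (Runs.forUp (fun i τ => τ.reg 2 = i ∧ τ.reg 14 = i * n ∧ τ.reg 0 = n ∧
    τ.reg 1 = σ.reg 1 ∧ τ.arr 0 = σ.arr 0 ∧ ∀ k < i, τ.arr 2 k = k * n) (N := n + 1) (T := 20)
    (by simp [Exp.cost]) ?_ ?_ ?_).mono le_rfl ?_
  · simp [State.setReg, h0, h14]
  · rintro i - τ ⟨h1, -, h2, -⟩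
    exact ⟨h1, by simp [Exp.eval, h2]⟩
  · rintro i hi τ ⟨h1, h2, h3, h4, h5, h6⟩
    refine Runs.seq 3 17 le_rfl (Runs.put (by simp [Exp.cost]) (Runs.set (by simp [Exp.cost]) ?_))
    simp only [Exp.eval, State.setArr, State.setReg, h1, h2]
    refine ⟨by simp [h1], by simp, ?_, by simp [h3], by simp [h4], by simp [h5], ?_⟩
    · simp [h3, Nat.succ_mul]
    · intro k hk
      simp only [Function.update_self, Function.update_apply]
      split_ifs with h
      · rw [h]
      · exact h6 k (by omega)
  · rintro τ ⟨-, -, h3, h4, h5, h6⟩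
    exact ⟨h3, h4, h5, fun i hi => h6 i (by omega)⟩

theorem runs_copy (h0 : σ.reg 0 = n) (h1 : σ.reg 1 = s)
    (ha : ∀ u v : Fin n, σ.arr 0 ((u : ℕ) * n + v) = bit (G.Adj u v))
    (h2 : ∀ i ≤ n, σ.arr 2 i = i * n) :
    Runs copyProg σ (loopTime n (loopTime n 20)) fun τ => Env G G s τ := by
  let J : (Fin n → Fin n → Prop) → State → Prop := fun D τ => τ.reg 0 = n ∧ τ.reg 1 = s ∧
    τ.arr 0 = σ.arr 0 ∧ τ.arr 2 = σ.arr 2 ∧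
    ∀ u v : Fin n, D u v → τ.arr 1 ((u : ℕ) * n + v) = bit (G.Adj u v)
  have hset : ∀ {D τ}, J D τ → ∀ x m, 2 ≤ x → J D (τ.setReg x m) := by
    rintro D τ ⟨e1, e2, e3⟩ x m hx
    refine ⟨?_, ?_, e3⟩
    · simp only [State.setReg]
      rwa [Function.update_of_ne (by omega)]
    · simp only [State.setReg]
      rwa [Function.update_of_ne (by omega)]
  refine (Runs.forUp (fun i τ => τ.reg 3 = i ∧ J (fun u _ => (u : ℕ) < i) τ) (N := n)
    (T := loopTime n 20) (by simp [Exp.cost]) ?_ ?_ ?_).mono le_rfl ?_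
  · exact ⟨by simp [State.setReg], hset ⟨h0, h1, rfl, rfl, fun u v h =>
      absurd h (Nat.not_lt_zero _)⟩ 3 0 (by omega)⟩
  · rintro i - τ ⟨e1, e2⟩
    exact ⟨e1, e2.1⟩
  · rintro i hi τ ⟨e1, e2⟩
    refine (Runs.forUp (fun k ρ => ρ.reg 3 = i ∧ ρ.reg 4 = k ∧
      J (fun u v => (u : ℕ) < i ∨ ((u : ℕ) = i ∧ (v : ℕ) < k)) ρ) (N := n) (T := 20)
      (by simp [Exp.cost]) ?_ ?_ ?_).mono le_rfl ?_
    · refine ⟨by simpa [State.setReg] using e1, by simp [State.setReg], ?_⟩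
      simpa using hset e2 4 0 (by omega)
    · rintro k - ρ ⟨-, f1, f2⟩
      exact ⟨f1, f2.1⟩
    · rintro k hk ρ ⟨f1, f2, f3, f4, f5, f6, f7⟩
      refine Runs.put (by simp [Exp.cost, cell]) ?_
      have hc : (cell 3 4).eval ρ = i * n + k := by
        simp only [cell, Exp.eval, f1, f2, f6, h2 i hi.le]
      have hv : (Exp.get 0 (cell 3 4)).eval ρ = bit (G.Adj ⟨i, hi⟩ ⟨k, hk⟩) := by
        rw [Exp.eval, hc, f5]
        exact ha ⟨i, hi⟩ ⟨k, hk⟩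
      rw [hc, hv]
      have hJ : J (fun u v => (u : ℕ) < i ∨ ((u : ℕ) = i ∧ (v : ℕ) < k + 1))
          (ρ.setArr 1 (i * n + k) (bit (G.Adj ⟨i, hi⟩ ⟨k, hk⟩))) := by
        refine ⟨f3, f4, by simpa [State.setArr] using f5, by simpa [State.setArr] using f6, ?_⟩
        intro u v hD
        have hcode := code_inj (u := u) (v := v) (u' := ⟨i, hi⟩) (v' := ⟨k, hk⟩)
        simp only [State.setArr, Function.update_self, Function.update_apply]
        split_ifs with h
        · obtain ⟨rfl, rfl⟩ := hcode.1 h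
          rfl
        · refine f7 u v ?_
          have : ¬ (u = ⟨i, hi⟩ ∧ v = ⟨k, hk⟩) := fun h' => h (hcode.2 h')
          simp only [Fin.ext_iff] at this
          omega
      exact ⟨f2, by simpa [State.setReg, State.setArr] using f1, by simp [State.setReg],
        hset hJ 4 _ (by omega)⟩
    · rintro ρ ⟨f1, -, f3⟩
      refine ⟨f1, by simp [State.setReg], hset ⟨f3.1, f3.2.1, f3.2.2.1, f3.2.2.2.1,
        fun u v hD => f3.2.2.2.2 u v ?_⟩ 3 _ (by omega)⟩
      have := v.2
      omega
  · rintro τ ⟨-, f1, f2, f3, f4, f5⟩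
    exact ⟨f1, f2, by rwa [f3], fun u v => f5 u v u.2, by rwa [f4]⟩

theorem runs_greedy (G : SimpleGraph (Fin n)) (s : Fin n) :
    Runs greedyProg (input G s) (greedyTime n) fun τ =>
      ∃ H, Outputs τ H ∧ Reduced G s (fun _ _ => True) H := by
  have hin : ∀ u v : Fin n, (input G s).arr 0 ((u : ℕ) * n + v) = bit (G.Adj u v) := by
    intro u v
    simp only [input, bit]
    congr 1
    rw [eq_iff_iff]
    constructor
    · rintro ⟨-, u', v', e, h⟩
      obtain ⟨rfl, rfl⟩ := code_inj.1 e
      exact h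
    · exact fun h => ⟨rfl, u, v, rfl, h⟩
  refine Runs.seq (loopTime (n + 1) 20)
    (loopTime n (loopTime n 20) + loopTime n (loopTime n (testTime n + 60))) le_rfl ?_
  refine (runs_multiples (n := n) (by simp [input]) (by simp [input])).mono le_rfl ?_
  rintro σ ⟨h0, h1, ha, h2⟩
  refine Runs.seq (loopTime n (loopTime n 20)) (loopTime n (loopTime n (testTime n + 60)))
    le_rfl ?_
  refine (runs_copy (G := G) (s := s) h0 (h1.trans (by simp [input])) (by rw [ha]; exact hin)
    h2).mono le_rfl ?_
  intro τ hE
  refine (runs_greedy_loops hE).mono le_rfl ?_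
  rintro ρ ⟨H, hH, hR⟩
  exact ⟨H, hH.arr1, hR⟩

end RAM

theorem theorem1 :
    ∃ (prog : RAM.Prog) (time : Polynomial ℕ) (C : ℝ),
      ∀ (n : ℕ) (G : SimpleGraph (Fin n)) (s : Fin n),
        ∃ (H : SimpleGraph (Fin n)) (t : ℕ) (τ : RAM.State),
          RAM.Exec prog (RAM.input G s) t τ ∧
          t ≤ time.eval n ∧
          RAM.Outputs τ H ∧
          IsFTBFS 2 G s H ∧
          (H.edgeSet.ncard : ℝ) ≤ C * (n : ℝ) ^ ((5 : ℝ) / 3) := by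
  refine ⟨RAM.greedyProg, RAM.greedyTime Polynomial.X, 30, fun n G s => ?_⟩
  obtain ⟨t, τ, hexec, ht, H, hout, hH, hmin⟩ := RAM.runs_greedy G s
  refine ⟨H, t, τ, hexec, by rwa [RAM.eval_greedyTime], hout, hH, ?_⟩
  have hn : 0 < n := Nat.zero_lt_of_lt s.2
  obtain ⟨k, hk, hbound⟩ := edge_bound_le hn
  refine le_trans ?_ hbound
  have hmin' : ∀ e ∈ H.edgeSet, ¬ IsFTBFS 2 G s (H.deleteEdges {e}) := by
    intro e he
    induction e using Sym2.ind with | _ u v => exact hmin u v trivial he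
  have := ncard_edgeSet_le hH hmin' hk
  rw [Fintype.card_fin] at this
  exact_mod_cast this
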